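/- Let $\gamma>0$ and consider the continuous-time random walk $(X(t),Y(t))_{t\ge 0}$ in the plane, started at the deterministic point $(X(0),Y(0))$, with navigation matrix $$\begin{pmatrix}-\gamma&-\gamma\\ \gamma&\gamma\end{pmatrix}.$$ That is, when the walk is at $(x,y)$, the waiting time until the next renewal is exponential with rate $x+y$; independently of this waiting time, the renewal is of the first type with probability $x/(x+y)$ and then $(-\gamma,-\gamma)$ is added to the position, and it is of the second type with probability $y/(x+y)$ and then $(\gamma,\gamma)$ is added. Assume that $\lambda:=Y(0)-X(0)>0$ and that the walk is tenable: every position that can be reached from $(X(0),Y(0))$ by finitely many renewals of positive rate has nonnegative coordinates and is not the origin. (Equivalently here, $X(0)/\gamma$ is a nonnegative integer.) Then the following hold. 1. For all $t\ge 0$ and all real $u$ with $\gamma t(e^{\gamma u}-1)<1$, the variable $e^{uX(t)}$ is integrable and $$\mathbb E\bigl[e^{uX(t)}\bigr]=\frac{1}{\bigl(1-\gamma t(e^{\gamma u}-1)\bigr)^{\lambda/\gamma}}\left(\frac{e^{\gamma u}-\gamma t(e^{\gamma u}-1)}{1-\gamma t(e^{\gamma u}-1)}\right)^{X(0)/\gamma}=\frac{\bigl(e^{\gamma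 u}-\gamma t(e^{\gamma u}-1)\bigr)^{X(0)/\gamma}}{\bigl(1-\gamma t(e^{\gamma u}-1)\bigr)^{Y(0)/\gamma}} .$$ 2. For all $t\ge 0$, $X(t)$ and $Y(t)$ are square integrable, with $\mathbb E[X(t)]=\lambda\gamma t+X(0)$, $\mathbb E[Y(t)]=\lambda\gamma t+Y(0)$ and $$\operatorname{Var}[X(t)]=\operatorname{Var}[Y(t)]=\lambda\gamma^3t^2+(2X(0)+\lambda)\gamma^2t .$$ 3. For every real $s$ with $\gamma^2 s<1$, the expectation $\mathbb E[e^{sX(t)/t}]$ is finite for all sufficiently large $t$, and $$\lim_{t\to\infty}\mathbb E\bigl[e^{sX(t)/t}\bigr]=\frac1{(1-\gamma^2 s)^{\lambda/\gamma}} .$$ 4. As $t\to\infty$, $X(t)/t$ converges in distribution to the gamma distribution with shape $\lambda/\gamma$ and scale $\gamma^2$, and so does $Y(t)/t$. -/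

import Mathlib

open MeasureTheory ProbabilityTheory Filter Topology
open scoped NNReal

namespace PolyaWalk

variable {c : ℕ}

/-- The states that the walk with navigation matrix `A` can reach from `x₀`: a renewal of colour `i`
is possible at `x` when its rate `x i` is positive, and it adds row `i` of `A` to the position. -/
inductive Reachable (A : Matrix (Fin c) (Fin c) ℝ) (x₀ : Fin c → ℝ) : (Fin c → ℝ) → Prop
  | start : Reachable A x₀ x₀
  | step {x : Fin c → ℝ} (i : Fin c) (hx : Reachable A x₀ x) (hi : 0 < x i) :
      Reachable A x₀ (x + A i)

/-- Tenability: whichever stochastic path is followed, all coordinates stay nonnegative and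
the origin is avoided. -/
def Tenable (A : Matrix (Fin c) (Fin c) ℝ) (x₀ : Fin c → ℝ) : Prop :=
  ∀ x, Reachable A x₀ x → (∀ i, 0 ≤ x i) ∧ x ≠ 0

variable {Ω : Type*}

/-- Position after the first `n` renewals, whose colours are `κ 0, …, κ (n - 1)`. -/
def position (A : Matrix (Fin c) (Fin c) ℝ) (x₀ : Fin c → ℝ) (κ : ℕ → Ω → Fin c)
    (n : ℕ) (ω : Ω) : Fin c → ℝ :=
  x₀ + ∑ k ∈ Finset.range n, A (κ k ω)

/-- Time of the `n`-th renewal (`0` for `n = 0`), the successive waiting times being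
`τ 0, τ 1, …`. -/
def renewalTime (τ : ℕ → Ω → ℝ) (n : ℕ) (ω : Ω) : ℝ :=
  ∑ k ∈ Finset.range n, τ k ω

/-- The σ-algebra generated by the first `n` waiting times and colours. -/
abbrev history (τ : ℕ → Ω → ℝ) (κ : ℕ → Ω → Fin c) (n : ℕ) : MeasurableSpace Ω :=
  ⨆ k : Fin n, MeasurableSpace.comap (fun ω => (τ k ω, κ k ω)) inferInstance

/-- `τ n` and `κ n` are the successive waiting times and colours of the renewals of the walk with
navigation matrix `A` started at `x₀`. Given the first `n` renewals, and with `z` the current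
position, the next waiting time is exponential with rate `∑ j, z j`, and, independently of it, the
next colour is `i` with probability `z i / ∑ j, z j`. -/
structure IsRenewalSequence [MeasurableSpace Ω] (P : Measure Ω)
    (A : Matrix (Fin c) (Fin c) ℝ) (x₀ : Fin c → ℝ)
    (τ : ℕ → Ω → ℝ) (κ : ℕ → Ω → Fin c) : Prop where
  measurable_waiting : ∀ n, Measurable (τ n)
  measurable_colour : ∀ n, Measurable (κ n)
  cond_law : ∀ (n : ℕ) (i : Fin c) (s : ℝ), 0 ≤ s →
    P⟦{ω | s < τ n ω ∧ κ n ω = i} | history τ κ n⟧ =ᵐ[P] fun ω =>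
      Real.exp (-(s * ∑ j, position A x₀ κ n ω j)) *
        (position A x₀ κ n ω i / ∑ j, position A x₀ κ n ω j)

/-- `X` is a continuum Pólya-like random walk with (deterministic) navigation matrix `A` and
initial position `x₀`: it sits at the `n`-th position from the `n`-th renewal until the next. -/
def IsContinuumPolyaWalk [MeasurableSpace Ω] (P : Measure Ω)
    (A : Matrix (Fin c) (Fin c) ℝ) (x₀ : Fin c → ℝ) (X : ℝ≥0 → Ω → Fin c → ℝ) : Prop :=
  ∃ (τ : ℕ → Ω → ℝ) (κ : ℕ → Ω → Fin c), IsRenewalSequence P A x₀ τ κ ∧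
    ∀ᵐ ω ∂P, ∀ (n : ℕ) (t : ℝ≥0),
      renewalTime τ n ω ≤ t → t < renewalTime τ (n + 1) ω → X t ω = position A x₀ κ n ω

end PolyaWalk

/-!
Let `u t z` be an explicit nonnegative solution of the Kolmogorov backward equation. Conditioning on
the first renewal shows that `u (t - Tₙ) Zₙ`, where `Tₙ` and `Zₙ` are the time and the position
after `n` renewals, frozen at the value `u 0 (X t)` once `Tₙ > t`, is a martingale in `n`. Renewals
do not accumulate, because the rate `∑ j, Zₙ j` grows at most linearly in `n`; letting `n → ∞`,
Fatou's lemma gives `𝔼 [u 0 (X t)] ≤ u t x₀`, with equality when `u` is bounded.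

For the matrix `!![-γ, -γ; γ, γ]` the difference of the coordinates is conserved, and with
`w = exp (γ * u)` the function `(w - γt(w-1)) ^ (z₀/γ) / (1 - γt(w-1)) ^ (z₁/γ)` is such a
solution with initial value `exp (u * z₀)`. It is bounded for `u ≤ 0`, which determines the moment
generating function there; Fatou's bound makes this function analytic on all of
`{u | γt(exp (γu) - 1) < 1}`, where the formula therefore persists. The moments come from its
logarithm at `0`. Convergence in distribution of nonnegative variables `W` follows from that of
`𝔼 [exp (-k * W)]`, `k : ℕ`, which are the moments of the bounded variable `exp (-W)`.
-/

lemma tendstoInMeasure_const_of_tendsto {ι α E : Type*} [MeasurableSpace α] {μ : Measure α}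
    [PseudoEMetricSpace E] {l : Filter ι} {c : ι → E} {a : E} (h : Tendsto c l (𝓝 a)) :
    TendstoInMeasure μ (fun i _ => c i) l fun _ => a := fun ε hε => by
  refine tendsto_nhds_of_eventually_eq ?_
  filter_upwards [(tendsto_iff_edist_tendsto_0.1 h).eventually_lt_const hε] with i hi
  simp [not_le.2 hi]

section ConvergenceInDistribution

variable {ι Ω Ω' : Type*} {l : Filter ι} [MeasurableSpace Ω] [MeasurableSpace Ω']
  {μ : ι → Measure Ω} [∀ i, IsProbabilityMeasure (μ i)] {ν : Measure Ω'} [IsProbabilityMeasure ν]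

lemma tendstoInDistribution_of_isInducing_comp {E F : Type*} [MeasurableSpace E]
    [PseudoEMetricSpace E] [OpensMeasurableSpace E] [MeasurableSpace F] [TopologicalSpace F]
    [BorelSpace F] [HasOuterApproxClosed F] [l.IsCountablyGenerated] {φ : E → F}
    (hφ : IsInducing φ) {W : ι → Ω → E} {Z : Ω' → E} (hW : ∀ i, AEMeasurable (W i) (μ i))
    (hZ : AEMeasurable Z ν)
    (h : TendstoInDistribution (fun i => φ ∘ W i) l (φ ∘ Z) μ ν) :
    TendstoInDistribution W l Z μ ν where
  forall_aemeasurable := hW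
  aemeasurable_limit := hZ
  tendsto := by
    refine tendsto_of_forall_isOpen_le_liminf' fun G hG => ?_
    obtain ⟨V, hV, rfl⟩ := hφ.isOpen_iff.1 hG
    have hliminf := ProbabilityMeasure.le_liminf_measure_open_of_tendsto h.tendsto hV
    have hφm := hφ.continuous.measurable
    simpa only [ProbabilityMeasure.coe_mk,
      Measure.map_apply_of_aemeasurable (hφm.comp_aemeasurable (hW _)) hV.measurableSet,
      Measure.map_apply_of_aemeasurable (hφm.comp_aemeasurable hZ) hV.measurableSet,
      Measure.map_apply_of_aemeasurable (hW _) hG.measurableSet,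
      Measure.map_apply_of_aemeasurable hZ hG.measurableSet, Set.preimage_comp] using hliminf

lemma integrable_comp_of_ae_mem_Icc {ρ : Measure Ω} [IsFiniteMeasure ρ] {W : Ω → ℝ} {g : ℝ → ℝ}
    {a b : ℝ} (hg : Continuous g) (hWm : AEMeasurable W ρ) (hW : ∀ᵐ ω ∂ρ, W ω ∈ Set.Icc a b) :
    Integrable (fun ω => g (W ω)) ρ := by
  obtain ⟨C, hC⟩ := isCompact_Icc.exists_bound_of_continuousOn (hg.continuousOn (s := Set.Icc a b))
  exact .of_bound (hg.measurable.comp_aemeasurable hWm).aestronglyMeasurable C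
    (hW.mono fun ω hω => hC _ hω)

lemma abs_integral_comp_sub_le_of_ae_mem_Icc {W : Ω' → ℝ} {f g : ℝ → ℝ} {a b ε : ℝ}
    (hf : Continuous f) (hg : Continuous g) (hfg : ∀ x ∈ Set.Icc a b, |f x - g x| ≤ ε)
    (hWm : AEMeasurable W ν) (hW : ∀ᵐ ω ∂ν, W ω ∈ Set.Icc a b) :
    |∫ ω, f (W ω) ∂ν - ∫ ω, g (W ω) ∂ν| ≤ ε := by
  rw [← integral_sub (integrable_comp_of_ae_mem_Icc hf hWm hW)
    (integrable_comp_of_ae_mem_Icc hg hWm hW)]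
  simpa using norm_integral_le_of_norm_le_const (hW.mono fun ω hω => hfg _ hω :
    ∀ᵐ ω ∂ν, ‖f (W ω) - g (W ω)‖ ≤ ε)

lemma integral_eval_of_ae_mem_Icc {ρ : Measure Ω} [IsFiniteMeasure ρ] {W : Ω → ℝ} {a b : ℝ}
    (hWm : AEMeasurable W ρ) (hW : ∀ᵐ ω ∂ρ, W ω ∈ Set.Icc a b) (p : Polynomial ℝ) :
    ∫ ω, p.eval (W ω) ∂ρ = ∑ k ∈ Finset.range (p.natDegree + 1), p.coeff k * ∫ ω, W ω ^ k ∂ρ := by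
  simp_rw [Polynomial.eval_eq_sum_range]
  rw [integral_finsetSum _ fun k _ =>
    (integrable_comp_of_ae_mem_Icc (continuous_pow k) hWm hW).const_mul _]
  simp_rw [integral_const_mul]

/-- By the Weierstrass theorem, test functions may be replaced by polynomials. -/
lemma tendstoInDistribution_of_tendsto_moments {W : ι → Ω → ℝ} {Z : Ω' → ℝ} {a b : ℝ}
    (hWm : ∀ i, AEMeasurable (W i) (μ i)) (hZm : AEMeasurable Z ν)
    (hW : ∀ i, ∀ᵐ ω ∂μ i, W i ω ∈ Set.Icc a b) (hZ : ∀ᵐ ω ∂ν, Z ω ∈ Set.Icc a b)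
    (h : ∀ k : ℕ, Tendsto (fun i => ∫ ω, W i ω ^ k ∂μ i) l (𝓝 (∫ ω, Z ω ^ k ∂ν))) :
    TendstoInDistribution W l Z μ ν where
  forall_aemeasurable := hWm
  aemeasurable_limit := hZm
  tendsto := by
    refine ProbabilityMeasure.tendsto_iff_forall_integral_tendsto.2 fun f => ?_
    simp only [ProbabilityMeasure.coe_mk]
    simp_rw [integral_map (hWm _) f.continuous.aestronglyMeasurable,
      integral_map hZm f.continuous.aestronglyMeasurable]
    refine Metric.tendsto_nhds.2 fun ε hε => ?_
    obtain ⟨p, hp⟩ := exists_polynomial_near_of_continuousOn a b f f.continuous.continuousOn (ε / 3)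
      (by positivity)
    have hfp : ∀ x ∈ Set.Icc a b, |f x - p.eval x| ≤ ε / 3 := fun x hx =>
      abs_sub_comm (f x) _ ▸ (hp x hx).le
    have hpoly : Tendsto (fun i => ∫ ω, p.eval (W i ω) ∂μ i) l (𝓝 (∫ ω, p.eval (Z ω) ∂ν)) := by
      simp_rw [integral_eval_of_ae_mem_Icc (hWm _) (hW _), integral_eval_of_ae_mem_Icc hZm hZ]
      exact tendsto_finsetSum _ fun k _ => (h k).const_mul _
    filter_upwards [Metric.tendsto_nhds.1 hpoly (ε / 3) (by positivity)] with i hi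
    have hWp := abs_integral_comp_sub_le_of_ae_mem_Icc f.continuous p.continuous hfp (hWm i) (hW i)
    have hZp := abs_integral_comp_sub_le_of_ae_mem_Icc f.continuous p.continuous hfp hZm hZ
    rw [Real.dist_eq] at hi ⊢
    rw [abs_lt] at hi ⊢
    rw [abs_le] at hWp hZp
    constructor <;> linarith

lemma isInducing_exp_neg : IsInducing fun x : ℝ => Real.exp (-x) :=
  (IsInducing.subtypeVal.comp Real.expOrderIso.toHomeomorph.isInducing).comp
    (Homeomorph.neg ℝ).isInducing

/-- In the variable `exp (-W i)`, with values in `[0, 1]`, Laplace transforms become moments. -/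
lemma tendstoInDistribution_of_tendsto_mgf_of_nonneg [l.IsCountablyGenerated]
    {W : ι → Ω → ℝ} {Z : Ω' → ℝ} (hWm : ∀ i, AEMeasurable (W i) (μ i)) (hZm : AEMeasurable Z ν)
    (hW : ∀ i, 0 ≤ᵐ[μ i] W i) (hZ : 0 ≤ᵐ[ν] Z)
    (h : ∀ s ≤ 0, Tendsto (fun i => mgf (W i) (μ i) s) l (𝓝 (mgf Z ν s))) :
    TendstoInDistribution W l Z μ ν := by
  have hm : Measurable fun x : ℝ => Real.exp (-x) := by fun_prop
  have hmem : ∀ {x : ℝ}, 0 ≤ x → Real.exp (-x) ∈ Set.Icc 0 1 := fun hx =>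
    ⟨(Real.exp_pos _).le, Real.exp_le_one_iff.2 (neg_nonpos.2 hx)⟩
  have hpow : ∀ (k : ℕ) (x : ℝ), Real.exp (-x) ^ k = Real.exp (-k * x) := fun k x => by
    rw [← Real.exp_nat_mul]; ring_nf
  refine tendstoInDistribution_of_isInducing_comp isInducing_exp_neg hWm hZm ?_
  refine tendstoInDistribution_of_tendsto_moments (a := 0) (b := 1)
    (fun i => hm.comp_aemeasurable (hWm i)) (hm.comp_aemeasurable hZm)
    (fun i => (hW i).mono fun ω => hmem) (hZ.mono fun ω => hmem) fun k => ?_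
  simpa only [Function.comp_apply, hpow, mgf] using h (-k) (by simp)

end ConvergenceInDistribution

section Gamma

variable {a r s : ℝ}

lemma exp_mul_gammaPDFReal (hr : 0 < r) (hs : s < r) (x : ℝ) :
    Real.exp (s * x) * gammaPDFReal a r x = (r / (r - s)) ^ a * gammaPDFReal a (r - s) x := by
  have hrs : 0 < r - s := sub_pos.2 hs
  have := Real.rpow_pos_of_pos hrs a
  unfold gammaPDFReal
  split_ifs
  · have hexp : Real.exp (-((r - s) * x)) = Real.exp (s * x) * Real.exp (-(r * x)) := by
      rw [← Real.exp_add]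
      ring_nf
    rw [hexp, Real.div_rpow hr.le hrs.le]
    field_simp
  · simp

lemma integral_gammaMeasure (ha : 0 < a) (hr : 0 < r) (f : ℝ → ℝ) :
    ∫ x, f x ∂gammaMeasure a r = ∫ x, f x * gammaPDFReal a r x := by
  have hm : Measurable (gammaPDF a r) := (measurable_gammaPDFReal a r).ennreal_ofReal
  rw [gammaMeasure, integral_withDensity_eq_integral_toReal_smul hm
    (ae_of_all _ fun _ => ENNReal.ofReal_lt_top)]
  simp [gammaPDF, ENNReal.toReal_ofReal (gammaPDFReal_nonneg ha hr _), mul_comm]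

lemma ae_nonneg_gammaMeasure : ∀ᵐ x ∂gammaMeasure a r, 0 ≤ x := by
  refine (ae_withDensity_iff (measurable_gammaPDFReal a r).ennreal_ofReal).2
    (ae_of_all _ fun x hx => ?_)
  by_contra! hneg
  exact hx (gammaPDF_of_neg hneg)

lemma mgf_id_gammaMeasure (ha : 0 < a) (hr : 0 < r) (hs : s < r) :
    mgf id (gammaMeasure a r) s = (r / (r - s)) ^ a := by
  have hrs : 0 < r - s := sub_pos.2 hs
  have : IsProbabilityMeasure (gammaMeasure a (r - s)) := isProbabilityMeasure_gammaMeasure ha hrs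
  have htotal := integral_gammaMeasure ha hrs fun _ => 1
  rw [integral_const, probReal_univ] at htotal
  simp only [one_smul, one_mul] at htotal
  simp only [mgf, id, integral_gammaMeasure ha hr, exp_mul_gammaPDFReal hr hs]
  rw [integral_const_mul, ← htotal, mul_one]

lemma mgf_id_gammaMeasure_one_div {θ : ℝ} (ha : 0 < a) (hθ : 0 < θ) (hs : θ * s < 1) :
    mgf id (gammaMeasure a (1 / θ)) s = 1 / (1 - θ * s) ^ a := by
  have hbase : 1 / θ / (1 / θ - s) = (1 - θ * s)⁻¹ := by field_simp
  rw [mgf_id_gammaMeasure ha (one_div_pos.2 hθ) ((lt_div_iff₀' hθ).2 hs), hbase,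
    Real.inv_rpow (sub_pos.2 hs).le, one_div]

end Gamma

namespace PolyaWalk

section Renewal

variable {c : ℕ} {Ω : Type*} {A : Matrix (Fin c) (Fin c) ℝ} {x₀ : Fin c → ℝ}
  {τ : ℕ → Ω → ℝ} {κ : ℕ → Ω → Fin c}

lemma position_zero (ω : Ω) : position A x₀ κ 0 ω = x₀ := by
  simp [position]

lemma position_succ (n : ℕ) (ω : Ω) :
    position A x₀ κ (n + 1) ω = position A x₀ κ n ω + A (κ n ω) := by
  simp [position, Finset.sum_range_succ, add_assoc]

lemma renewalTime_zero (ω : Ω) : renewalTime τ 0 ω = 0 := by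
  simp [renewalTime]

lemma renewalTime_succ (n : ℕ) (ω : Ω) :
    renewalTime τ (n + 1) ω = renewalTime τ n ω + τ n ω := by
  simp [renewalTime, Finset.sum_range_succ]

lemma measurable_history_waiting_colour (τ : ℕ → Ω → ℝ) (κ : ℕ → Ω → Fin c) {n k : ℕ}
    (hk : k < n) : Measurable[history τ κ n] fun ω => (τ k ω, κ k ω) :=
  (comap_measurable _).mono
    (le_iSup (fun k : Fin n => MeasurableSpace.comap (fun ω => (τ k ω, κ k ω)) inferInstance)
      ⟨k, hk⟩) le_rfl

lemma measurable_history_renewalTime (τ : ℕ → Ω → ℝ) (κ : ℕ → Ω → Fin c) (n : ℕ) :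
    Measurable[history τ κ n] (renewalTime τ n) := by
  unfold renewalTime
  refine Finset.measurable_fun_sum _ fun k hk => ?_
  exact measurable_fst.comp (measurable_history_waiting_colour τ κ (Finset.mem_range.1 hk))

lemma measurable_history_position (A : Matrix (Fin c) (Fin c) ℝ) (x₀ : Fin c → ℝ)
    (τ : ℕ → Ω → ℝ) (κ : ℕ → Ω → Fin c) (n : ℕ) :
    Measurable[history τ κ n] (position A x₀ κ n) := by
  unfold position
  refine Measurable.const_add (Finset.measurable_fun_sum _ fun k hk => ?_) _
  exact (measurable_of_finite A).comp
    (measurable_snd.comp (measurable_history_waiting_colour τ κ (Finset.mem_range.1 hk)))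

lemma Tenable.nonneg_and_sum_pos (hten : Tenable A x₀) {x : Fin c → ℝ} (hx : Reachable A x₀ x) :
    (∀ i, 0 ≤ x i) ∧ 0 < ∑ j, x j := by
  obtain ⟨hnonneg, hne⟩ := hten x hx
  refine ⟨hnonneg, (Finset.sum_nonneg fun i _ => hnonneg i).lt_of_ne fun hs => hne ?_⟩
  funext i
  exact (Finset.sum_eq_zero_iff_of_nonneg fun i _ => hnonneg i).1 hs.symm i (Finset.mem_univ i)

variable [MeasurableSpace Ω] {P : Measure Ω}

namespace IsRenewalSequence

lemma history_le (h : IsRenewalSequence P A x₀ τ κ) (n : ℕ) :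
    history τ κ n ≤ ‹MeasurableSpace Ω› :=
  iSup_le fun k => ((h.measurable_waiting k).prodMk (h.measurable_colour k)).comap_le

lemma measurable_renewalTime (h : IsRenewalSequence P A x₀ τ κ) (n : ℕ) :
    Measurable (renewalTime τ n) :=
  (measurable_history_renewalTime τ κ n).mono (h.history_le n) le_rfl

lemma measurable_position (h : IsRenewalSequence P A x₀ τ κ) (n : ℕ) :
    Measurable (position A x₀ κ n) :=
  (measurable_history_position A x₀ τ κ n).mono (h.history_le n) le_rfl

lemma measurableSet_colour_eq (h : IsRenewalSequence P A x₀ τ κ) (n : ℕ) (i : Fin c) :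
    MeasurableSet {ω | κ n ω = i} :=
  h.measurable_colour n (measurableSet_singleton i)

lemma measurableSet_waiting_colour (h : IsRenewalSequence P A x₀ τ κ) (n : ℕ) (i : Fin c) (s : ℝ) :
    MeasurableSet {ω | s < τ n ω ∧ κ n ω = i} :=
  (measurableSet_lt measurable_const (h.measurable_waiting n)).inter (h.measurableSet_colour_eq n i)

variable [IsProbabilityMeasure P]

lemma measure_inter_waiting_colour (h : IsRenewalSequence P A x₀ τ κ) (n : ℕ) (i : Fin c) {s : ℝ}
    (hs : 0 ≤ s) {S : Set Ω} (hS : MeasurableSet[history τ κ n] S) :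
    P (S ∩ {ω | s < τ n ω ∧ κ n ω = i}) = ∫⁻ ω in S, ENNReal.ofReal
      (Real.exp (-(s * ∑ j, position A x₀ κ n ω j)) *
        (position A x₀ κ n ω i / ∑ j, position A x₀ κ n ω j)) ∂P := by
  have hB := h.measurableSet_waiting_colour n i s
  have hnonneg : 0 ≤ᵐ[P] P⟦{ω | s < τ n ω ∧ κ n ω = i} | history τ κ n⟧ :=
    condExp_nonneg (ae_of_all _ fun ω => Set.indicator_nonneg (fun _ _ => zero_le_one) ω)
  have hset := setIntegral_condExp (h.history_le n)
    ((integrable_const (1 : ℝ) (μ := P)).indicator hB) hS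
  rw [integral_indicator hB, setIntegral_const, smul_eq_mul, mul_one, measureReal_def,
    Measure.restrict_apply hB, Set.inter_comm] at hset
  have hlaw := (h.cond_law n i s hs).mono fun ω hω => congrArg ENNReal.ofReal hω
  rw [← lintegral_congr_ae (ae_restrict_of_ae hlaw),
    ← ofReal_integral_eq_lintegral_ofReal integrable_condExp.integrableOn
      (ae_restrict_of_ae hnonneg),
    hset, ENNReal.ofReal_toReal (measure_ne_top _ _)]

/-- The colour probabilities at the current position add up to one. -/
lemma ae_waiting_pos_of_nonneg (h : IsRenewalSequence P A x₀ τ κ) (n : ℕ)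
    (hz : ∀ᵐ ω ∂P, (∀ i, 0 ≤ position A x₀ κ n ω i) ∧ 0 < ∑ j, position A x₀ κ n ω j) :
    ∀ᵐ ω ∂P, 0 < τ n ω := by
  have hpos := h.measurable_position n
  have hunion : {ω | 0 < τ n ω} = ⋃ i, {ω | 0 < τ n ω ∧ κ n ω = i} := by
    ext ω
    simp
  have hcolour : ∀ i, P {ω | 0 < τ n ω ∧ κ n ω = i} =
      ∫⁻ ω, ENNReal.ofReal (position A x₀ κ n ω i / ∑ j, position A x₀ κ n ω j) ∂P := fun i => by
    simpa using h.measure_inter_waiting_colour n i le_rfl (S := Set.univ) MeasurableSet.univ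
  refine (mem_ae_iff_prob_eq_one (measurableSet_lt measurable_const (h.measurable_waiting n))).2 ?_
  calc P {ω | 0 < τ n ω}
      = ∑ i, ∫⁻ ω, ENNReal.ofReal
          (position A x₀ κ n ω i / ∑ j, position A x₀ κ n ω j) ∂P := by
        rw [hunion, measure_iUnion _ fun i => h.measurableSet_waiting_colour n i 0, tsum_fintype]
        · simp_rw [hcolour]
        · exact fun i j hij => Set.disjoint_left.2 fun ω hi hj => hij (hi.2.symm.trans hj.2)
    _ = ∫⁻ ω, ∑ i, ENNReal.ofReal
          (position A x₀ κ n ω i / ∑ j, position A x₀ κ n ω j) ∂P :=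
        (lintegral_finsetSum _ fun i _ => by fun_prop).symm
    _ = ∫⁻ _, 1 ∂P := lintegral_congr_ae <| hz.mono fun ω hω => by
        dsimp only
        rw [← ENNReal.ofReal_sum_of_nonneg fun i _ => div_nonneg (hω.1 i) hω.2.le,
          ← Finset.sum_div, div_self hω.2.ne', ENNReal.ofReal_one]
    _ = 1 := by simp

lemma ae_colour_rate_pos (h : IsRenewalSequence P A x₀ τ κ) (n : ℕ)
    (hz : ∀ᵐ ω ∂P, (∀ i, 0 ≤ position A x₀ κ n ω i) ∧ 0 < ∑ j, position A x₀ κ n ω j) :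
    ∀ᵐ ω ∂P, 0 < position A x₀ κ n ω (κ n ω) := by
  have hnull : ∀ᵐ ω ∂P, ∀ i, ¬(position A x₀ κ n ω i ≤ 0 ∧ 0 < τ n ω ∧ κ n ω = i) := by
    refine ae_all_iff.2 fun i => ?_
    have hS : MeasurableSet[history τ κ n] {ω | position A x₀ κ n ω i ≤ 0} :=
      ((measurable_pi_apply i).comp (measurable_history_position A x₀ τ κ n)) measurableSet_Iic
    refine measure_eq_zero_iff_ae_notMem.1
      ((h.measure_inter_waiting_colour n i le_rfl hS).trans ?_)
    refine (setLIntegral_congr_fun_ae (h.history_le n _ hS) ?_).trans lintegral_zero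
    filter_upwards [hz] with ω hω hi
    rw [le_antisymm hi (hω.1 i)]
    simp
  filter_upwards [hnull, h.ae_waiting_pos_of_nonneg n hz] with ω hω hτ
  exact not_le.1 fun hle => hω (κ n ω) ⟨hle, hτ, rfl⟩

lemma ae_reachable (h : IsRenewalSequence P A x₀ τ κ) (hten : Tenable A x₀) (n : ℕ) :
    ∀ᵐ ω ∂P, Reachable A x₀ (position A x₀ κ n ω) := by
  induction n with
  | zero => exact ae_of_all _ fun ω => by simpa only [position_zero] using Reachable.start
  | succ n ih =>
    filter_upwards [ih, h.ae_colour_rate_pos n (ih.mono fun ω => hten.nonneg_and_sum_pos)]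
      with ω hreach hrate
    rw [position_succ]
    exact hreach.step _ hrate

lemma ae_nonneg_and_sum_pos (h : IsRenewalSequence P A x₀ τ κ) (hten : Tenable A x₀) (n : ℕ) :
    ∀ᵐ ω ∂P, (∀ i, 0 ≤ position A x₀ κ n ω i) ∧ 0 < ∑ j, position A x₀ κ n ω j :=
  (h.ae_reachable hten n).mono fun _ => hten.nonneg_and_sum_pos

lemma ae_waiting_pos (h : IsRenewalSequence P A x₀ τ κ) (hten : Tenable A x₀) (n : ℕ) :
    ∀ᵐ ω ∂P, 0 < τ n ω :=
  h.ae_waiting_pos_of_nonneg n (h.ae_nonneg_and_sum_pos hten n)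

end IsRenewalSequence

/-- The density, at the waiting time `s`, of a renewal of colour `i` from the position `z`. -/
noncomputable def jumpDensity (z : Fin c → ℝ) (i : Fin c) (s : ℝ) : ENNReal :=
  ENNReal.ofReal (z i * Real.exp (-(s * ∑ j, z j)))

@[fun_prop]
lemma measurable_jumpDensity (i : Fin c) :
    Measurable fun p : (ℝ × (Fin c → ℝ)) × ℝ => jumpDensity p.1.2 i p.2 := by
  unfold jumpDensity
  fun_prop

lemma lintegral_Ioi_jumpDensity {z : Fin c → ℝ} (i : Fin c) (hi : 0 ≤ z i) (hz : 0 < ∑ j, z j)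
    (a : ℝ) : ∫⁻ s in Set.Ioi a, jumpDensity z i s =
      ENNReal.ofReal (Real.exp (-(a * ∑ j, z j)) * (z i / ∑ j, z j)) := by
  have hexp : ∀ s, -(s * ∑ j, z j) = (-∑ j, z j) * s := fun s => by ring
  unfold jumpDensity
  simp_rw [hexp]
  rw [← ofReal_integral_eq_lintegral_ofReal, integral_const_mul, integral_exp_mul_Ioi (by linarith)]
  · congr 1
    field_simp
  · exact (integrableOn_exp_mul_Ioi (by linarith) a).const_mul _
  · exact ae_of_all _ fun s => by positivity

end Renewal

section NextRenewal

lemma measure_eq_of_forall_prod_Ioi {α : Type*} [MeasurableSpace α] {μ ν : Measure (α × ℝ)}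
    [IsFiniteMeasure μ] {b : ℝ} (hμ : ∀ᵐ p ∂μ, b < p.2) (hν : ∀ᵐ p ∂ν, b < p.2)
    (h : ∀ S, MeasurableSet S → ∀ a, b ≤ a → μ (S ×ˢ Set.Ioi a) = ν (S ×ˢ Set.Ioi a)) :
    μ = ν := by
  have hprod : ∀ {ρ : Measure (α × ℝ)}, (∀ᵐ p ∂ρ, b < p.2) → ∀ S a,
      ρ (S ×ˢ Set.Ioi a) = ρ (S ×ˢ Set.Ioi (max a b)) := fun hρ S a =>
    measure_congr <| hρ.mono fun p hp => propext <| by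
      change p ∈ S ×ˢ Set.Ioi a ↔ p ∈ S ×ˢ Set.Ioi (max a b)
      simp [Set.mem_prod, hp]
  have huniv : ∀ {ρ : Measure (α × ℝ)}, (∀ᵐ p ∂ρ, b < p.2) →
      ρ Set.univ = ρ (Set.univ ×ˢ Set.Ioi b) := fun hρ =>
    measure_congr <| hρ.mono fun p hp => propext <| by
      change p ∈ Set.univ ↔ p ∈ Set.univ ×ˢ Set.Ioi b
      simp [Set.mem_prod, hp]
  have hspan : IsCountablySpanning (Set.range (Set.Ioi : ℝ → Set ℝ)) := by
    refine ⟨fun k : ℕ => Set.Ioi (-(k : ℝ)), fun k => ⟨_, rfl⟩, Set.eq_univ_of_forall fun x => ?_⟩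
    obtain ⟨k, hk⟩ := exists_nat_gt (-x)
    exact Set.mem_iUnion.2 ⟨k, neg_lt.1 hk⟩
  refine ext_of_generate_finite
    (Set.image2 (· ×ˢ ·) {S : Set α | MeasurableSet S} (Set.range Set.Ioi))
    (generateFrom_eq_prod MeasurableSpace.generateFrom_measurableSet
      ((borel_eq_generateFrom_Ioi ℝ).symm.trans BorelSpace.measurable_eq.symm)
      isCountablySpanning_measurableSet hspan).symm
    (MeasurableSpace.isPiSystem_measurableSet.prod isPiSystem_Ioi) ?_ ?_
  · rintro _ ⟨S, hS, _, ⟨a, rfl⟩, rfl⟩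
    dsimp only
    rw [hprod hμ, hprod hν]
    exact h S hS _ (le_max_right _ _)
  · rw [huniv hμ, huniv hν]
    exact h _ MeasurableSet.univ b le_rfl

variable {c : ℕ} {Ω : Type*} [MeasurableSpace Ω] {P : Measure Ω} [IsProbabilityMeasure P]
  {A : Matrix (Fin c) (Fin c) ℝ} {x₀ : Fin c → ℝ} {τ : ℕ → Ω → ℝ} {κ : ℕ → Ω → Fin c}

namespace IsRenewalSequence

lemma map_restrict_colour_eq (h : IsRenewalSequence P A x₀ τ κ) (hten : Tenable A x₀) (n : ℕ)
    (i : Fin c) :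
    (P.restrict {ω | κ n ω = i}).map
        (fun ω => ((renewalTime τ n ω, position A x₀ κ n ω), τ n ω)) =
      ((P.map fun ω => (renewalTime τ n ω, position A x₀ κ n ω)).prod
        (volume.restrict (Set.Ioi 0))).withDensity fun p => jumpDensity p.1.2 i p.2 := by
  have hpast : Measurable fun ω => (renewalTime τ n ω, position A x₀ κ n ω) :=
    (h.measurable_renewalTime n).prodMk (h.measurable_position n)
  have hnext : Measurable fun ω => ((renewalTime τ n ω, position A x₀ κ n ω), τ n ω) :=
    hpast.prodMk (h.measurable_waiting n)
  refine measure_eq_of_forall_prod_Ioi (b := 0) ?_ ?_ fun S hS a ha => ?_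
  · rw [ae_map_iff hnext.aemeasurable (measurableSet_lt measurable_const measurable_snd)]
    exact ae_restrict_of_ae (h.ae_waiting_pos hten n)
  · exact (withDensity_absolutelyContinuous _ _).ae_le
      (Measure.quasiMeasurePreserving_snd.ae (ae_restrict_mem measurableSet_Ioi))
  have hSa : MeasurableSet (S ×ˢ Set.Ioi a) := hS.prod measurableSet_Ioi
  have hS_history := ((measurable_history_renewalTime τ κ n).prodMk
    (measurable_history_position A x₀ τ κ n)) hS
  rw [Measure.map_apply hnext hSa, Measure.restrict_apply (hnext hSa),
    withDensity_apply _ hSa, ← Measure.prod_restrict,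
    lintegral_prod _ (measurable_jumpDensity i).aemeasurable,
    Measure.restrict_restrict measurableSet_Ioi,
    Set.inter_eq_self_of_subset_left (Set.Ioi_subset_Ioi ha),
    setLIntegral_map hS (measurable_jumpDensity i).lintegral_prod_right' hpast]
  calc P ((fun ω => ((renewalTime τ n ω, position A x₀ κ n ω), τ n ω)) ⁻¹' S ×ˢ Set.Ioi a ∩
        {ω | κ n ω = i})
      = P ((fun ω => (renewalTime τ n ω, position A x₀ κ n ω)) ⁻¹' S ∩
          {ω | a < τ n ω ∧ κ n ω = i}) := by
        congr 1
        ext ω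
        simp only [Set.mem_inter_iff, Set.mem_preimage, Set.mem_prod, Set.mem_Ioi,
          Set.mem_ofPred_eq, and_assoc]
    _ = _ := (h.measure_inter_waiting_colour n i ha hS_history).trans <| lintegral_congr_ae <| by
        filter_upwards [ae_restrict_of_ae (h.ae_nonneg_and_sum_pos hten n)] with ω hω
        rw [lintegral_Ioi_jumpDensity i (hω.1 i) hω.2]

lemma setLIntegral_next_of_colour (h : IsRenewalSequence P A x₀ τ κ) (hten : Tenable A x₀) (n : ℕ)
    (i : Fin c) {f : (ℝ × (Fin c → ℝ)) × ℝ → ENNReal} (hf : Measurable f) :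
    ∫⁻ ω in {ω | κ n ω = i}, f ((renewalTime τ n ω, position A x₀ κ n ω), τ n ω) ∂P =
      ∫⁻ ω, (∫⁻ s in Set.Ioi 0, jumpDensity (position A x₀ κ n ω) i s *
        f ((renewalTime τ n ω, position A x₀ κ n ω), s)) ∂P := by
  have hpast : Measurable fun ω => (renewalTime τ n ω, position A x₀ κ n ω) :=
    (h.measurable_renewalTime n).prodMk (h.measurable_position n)
  have hdens := (measurable_jumpDensity i).mul hf
  rw [← lintegral_map hf (hpast.prodMk (h.measurable_waiting n)),
    h.map_restrict_colour_eq hten n i,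
    lintegral_withDensity_eq_lintegral_mul _ (measurable_jumpDensity i) hf,
    lintegral_prod _ hdens.aemeasurable, lintegral_map hdens.lintegral_prod_right' hpast]
  rfl

theorem lintegral_next (h : IsRenewalSequence P A x₀ τ κ) (hten : Tenable A x₀) (n : ℕ)
    {f : ℝ → (Fin c → ℝ) → ℝ → Fin c → ENNReal}
    (hf : ∀ i, Measurable fun p : (ℝ × (Fin c → ℝ)) × ℝ => f p.1.1 p.1.2 p.2 i) :
    ∫⁻ ω, f (renewalTime τ n ω) (position A x₀ κ n ω) (τ n ω) (κ n ω) ∂P =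
      ∫⁻ ω, (∑ i, ∫⁻ s in Set.Ioi 0, jumpDensity (position A x₀ κ n ω) i s *
        f (renewalTime τ n ω) (position A x₀ κ n ω) s i) ∂P := by
  have hpast : Measurable fun ω => (renewalTime τ n ω, position A x₀ κ n ω) :=
    (h.measurable_renewalTime n).prodMk (h.measurable_position n)
  have hunion : ⋃ i, {ω | κ n ω = i} = Set.univ := by
    ext ω
    simp
  have hmeas : ∀ i, Measurable fun ω => ∫⁻ s in Set.Ioi 0, jumpDensity (position A x₀ κ n ω) i s *
      f (renewalTime τ n ω) (position A x₀ κ n ω) s i := fun i =>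
    ((measurable_jumpDensity i).mul (hf i)).lintegral_prod_right'.comp hpast
  rw [lintegral_finsetSum _ fun i _ => hmeas i, ← setLIntegral_univ, ← hunion,
    lintegral_iUnion (h.measurableSet_colour_eq n)
      (fun i j hij => Set.disjoint_left.2 fun ω hi hj => hij (hi.symm.trans hj)), tsum_fintype]
  refine Finset.sum_congr rfl fun i _ => ?_
  rw [← h.setLIntegral_next_of_colour hten n i (hf i)]
  exact setLIntegral_congr_fun (h.measurableSet_colour_eq n i) fun ω (hω : κ n ω = i) => by
    simp only [hω]

end IsRenewalSequence

end NextRenewal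

section NonExplosion

variable {c : ℕ} {Ω : Type*} {A : Matrix (Fin c) (Fin c) ℝ} {x₀ : Fin c → ℝ}
  {τ : ℕ → Ω → ℝ} {κ : ℕ → Ω → Fin c}

lemma sum_position_le {C : ℝ} (hC : ∀ i, ∑ j, A i j ≤ C) (κ : ℕ → Ω → Fin c) (n : ℕ) (ω : Ω) :
    ∑ j, position A x₀ κ n ω j ≤ ∑ j, x₀ j + C * n := by
  induction n with
  | zero => simp [position_zero]
  | succ n ih =>
    have hrow := hC (κ n ω)
    simp only [position_succ, Pi.add_apply, Finset.sum_add_distrib]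
    push_cast
    linarith

lemma exists_pos_forall_sum_row_le (A : Matrix (Fin c) (Fin c) ℝ) :
    ∃ C : ℝ, 0 < C ∧ ∀ i, ∑ j, A i j ≤ C := by
  obtain ⟨C, hC⟩ := (Set.finite_range fun i => ∑ j, A i j).bddAbove
  exact ⟨max C 1, by positivity, fun i => (hC ⟨i, rfl⟩).trans (le_max_left _ _)⟩

lemma sum_lintegral_jumpDensity_mul_exp {z : Fin c → ℝ} (hnonneg : ∀ i, 0 ≤ z i)
    (hz : 0 < ∑ j, z j) {C : ℝ} (hC : 0 < C) :
    ∑ i, ∫⁻ s in Set.Ioi 0, jumpDensity z i s * ENNReal.ofReal (Real.exp (-(C * s))) =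
      ENNReal.ofReal ((∑ j, z j) / (∑ j, z j + C)) := by
  have hrate : -(∑ j, z j + C) < 0 := by linarith
  have hcolour : ∀ i, ∫⁻ s in Set.Ioi 0, jumpDensity z i s * ENNReal.ofReal (Real.exp (-(C * s))) =
      ENNReal.ofReal (z i / (∑ j, z j + C)) := fun i => by
    have hdens : ∀ s, jumpDensity z i s * ENNReal.ofReal (Real.exp (-(C * s))) =
        ENNReal.ofReal (z i * Real.exp (-(∑ j, z j + C) * s)) := fun s => by
      rw [jumpDensity, ← ENNReal.ofReal_mul (mul_nonneg (hnonneg i) (Real.exp_pos _).le), mul_assoc,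
        ← Real.exp_add]
      ring_nf
    simp_rw [hdens]
    rw [← ofReal_integral_eq_lintegral_ofReal ((integrableOn_exp_mul_Ioi hrate 0).const_mul _)
        (ae_of_all _ fun s => mul_nonneg (hnonneg i) (Real.exp_pos _).le),
      integral_const_mul, integral_exp_mul_Ioi hrate, mul_zero, Real.exp_zero, neg_div_neg_eq,
      mul_one_div]
  simp_rw [hcolour]
  rw [← ENNReal.ofReal_sum_of_nonneg fun i _ => div_nonneg (hnonneg i) (by linarith),
    ← Finset.sum_div]

variable [MeasurableSpace Ω] {P : Measure Ω} [IsProbabilityMeasure P]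

namespace IsRenewalSequence

lemma lintegral_exp_neg_renewalTime_succ (h : IsRenewalSequence P A x₀ τ κ) (hten : Tenable A x₀)
    {C : ℝ} (hC : 0 < C) (n : ℕ) :
    ∫⁻ ω, ENNReal.ofReal (Real.exp (-(C * renewalTime τ (n + 1) ω))) ∂P =
      ∫⁻ ω, ENNReal.ofReal (Real.exp (-(C * renewalTime τ n ω))) * ENNReal.ofReal
        ((∑ j, position A x₀ κ n ω j) / (∑ j, position A x₀ κ n ω j + C)) ∂P := by
  have hexp : ∀ ω, ENNReal.ofReal (Real.exp (-(C * renewalTime τ (n + 1) ω))) =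
      ENNReal.ofReal (Real.exp (-(C * renewalTime τ n ω))) *
        ENNReal.ofReal (Real.exp (-(C * τ n ω))) := fun ω => by
    rw [← ENNReal.ofReal_mul (Real.exp_pos _).le, ← Real.exp_add, renewalTime_succ]
    ring_nf
  simp_rw [hexp]
  rw [h.lintegral_next hten n (f := fun T _ s _ => ENNReal.ofReal (Real.exp (-(C * T))) *
    ENNReal.ofReal (Real.exp (-(C * s)))) fun _ => by fun_prop]
  refine lintegral_congr_ae ?_
  filter_upwards [h.ae_nonneg_and_sum_pos hten n] with ω hω
  rw [← sum_lintegral_jumpDensity_mul_exp hω.1 hω.2 hC, Finset.mul_sum]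
  refine Finset.sum_congr rfl fun i _ => ?_
  rw [← lintegral_const_mul' _ _ ENNReal.ofReal_ne_top]
  simp_rw [mul_left_comm]

lemma lintegral_exp_neg_renewalTime_le (h : IsRenewalSequence P A x₀ τ κ) (hten : Tenable A x₀)
    {C : ℝ} (hC : 0 < C) (hrow : ∀ i, ∑ j, A i j ≤ C) (n : ℕ) :
    ∫⁻ ω, ENNReal.ofReal (Real.exp (-(C * renewalTime τ n ω))) ∂P ≤
      ENNReal.ofReal ((∑ j, x₀ j) / (∑ j, x₀ j + C * n)) := by
  have hx₀ : 0 < ∑ j, x₀ j := (hten.nonneg_and_sum_pos .start).2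
  induction n with
  | zero => simp [renewalTime_zero, hx₀.ne']
  | succ n ih =>
    have hratio : ∀ᵐ ω ∂P, (∑ j, position A x₀ κ n ω j) / (∑ j, position A x₀ κ n ω j + C) ≤
        (∑ j, x₀ j + C * n) / (∑ j, x₀ j + C * (n + 1)) := by
      filter_upwards [h.ae_nonneg_and_sum_pos hten n] with ω hω
      have hle := sum_position_le (x₀ := x₀) hrow κ n ω
      rw [div_le_div_iff₀ (by linarith [hω.2]) (by positivity)]
      nlinarith
    calc ∫⁻ ω, ENNReal.ofReal (Real.exp (-(C * renewalTime τ (n + 1) ω))) ∂P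
        ≤ ∫⁻ ω, ENNReal.ofReal (Real.exp (-(C * renewalTime τ n ω))) *
            ENNReal.ofReal ((∑ j, x₀ j + C * n) / (∑ j, x₀ j + C * (n + 1))) ∂P := by
          rw [h.lintegral_exp_neg_renewalTime_succ hten hC n]
          exact lintegral_mono_ae <| hratio.mono fun ω hω => by gcongr
      _ ≤ ENNReal.ofReal ((∑ j, x₀ j) / (∑ j, x₀ j + C * n)) *
            ENNReal.ofReal ((∑ j, x₀ j + C * n) / (∑ j, x₀ j + C * (n + 1))) := by
          rw [lintegral_mul_const' _ _ ENNReal.ofReal_ne_top]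
          gcongr
      _ = ENNReal.ofReal ((∑ j, x₀ j) / (∑ j, x₀ j + C * ↑(n + 1))) := by
          rw [← ENNReal.ofReal_mul (by positivity), Nat.cast_add_one,
            div_mul_div_cancel₀ (by positivity)]

theorem tendsto_measure_renewalTime_le (h : IsRenewalSequence P A x₀ τ κ) (hten : Tenable A x₀)
    (T : ℝ) : Tendsto (fun n => P {ω | renewalTime τ n ω ≤ T}) atTop (𝓝 0) := by
  obtain ⟨C, hC, hrow⟩ := exists_pos_forall_sum_row_le A
  have hbound : ∀ n : ℕ, P {ω | renewalTime τ n ω ≤ T} ≤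
      ENNReal.ofReal ((∑ j, x₀ j) / (∑ j, x₀ j + C * n)) /
        ENNReal.ofReal (Real.exp (-(C * T))) := fun n => by
    have hm := h.measurable_renewalTime n
    calc P {ω | renewalTime τ n ω ≤ T}
        ≤ P {ω | ENNReal.ofReal (Real.exp (-(C * T))) ≤
            ENNReal.ofReal (Real.exp (-(C * renewalTime τ n ω)))} :=
          measure_mono fun ω (hω : renewalTime τ n ω ≤ T) =>
            ENNReal.ofReal_le_ofReal (Real.exp_le_exp.2 (by nlinarith))
      _ ≤ (∫⁻ ω, ENNReal.ofReal (Real.exp (-(C * renewalTime τ n ω))) ∂P) /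
            ENNReal.ofReal (Real.exp (-(C * T))) :=
          meas_ge_le_lintegral_div (by fun_prop)
            (ENNReal.ofReal_pos.2 (Real.exp_pos _)).ne' ENNReal.ofReal_ne_top
      _ ≤ _ := by
          gcongr
          exact h.lintegral_exp_neg_renewalTime_le hten hC hrow n
  have hratio : Tendsto (fun n : ℕ => (∑ j, x₀ j) / (∑ j, x₀ j + C * n)) atTop (𝓝 0) :=
    (tendsto_atTop_add_const_left _ _
      (tendsto_natCast_atTop_atTop.const_mul_atTop hC)).const_div_atTop _
  refine tendsto_of_tendsto_of_tendsto_of_le_of_le tendsto_const_nhds ?_ (fun _ => zero_le) hbound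
  simpa using ENNReal.Tendsto.div_const (ENNReal.tendsto_ofReal hratio)
    (.inr (ENNReal.ofReal_pos.2 (Real.exp_pos (-(C * T)))).ne')

lemma ae_exists_lt_renewalTime (h : IsRenewalSequence P A x₀ τ κ) (hten : Tenable A x₀)
    (T : ℝ) : ∀ᵐ ω ∂P, ∃ n, T < renewalTime τ n ω := by
  rw [ae_iff]
  refine le_antisymm (ge_of_tendsto' (h.tendsto_measure_renewalTime_le hten T)
    fun n => measure_mono fun ω hω => ?_) zero_le
  simp only [Set.mem_ofPred_eq, not_exists, not_lt] at hω
  exact hω n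

lemma ae_exists_renewalTime_le_lt (h : IsRenewalSequence P A x₀ τ κ) (hten : Tenable A x₀)
    (t : ℝ≥0) : ∀ᵐ ω ∂P, ∃ n, renewalTime τ n ω ≤ t ∧ t < renewalTime τ (n + 1) ω := by
  filter_upwards [h.ae_exists_lt_renewalTime hten t] with ω hex
  by_contra! hstay
  have hle : ∀ n, renewalTime τ n ω ≤ t := fun n => by
    induction n with
    | zero => simp [renewalTime_zero]
    | succ n ih => exact hstay n ih
  obtain ⟨n, hn⟩ := hex
  exact hn.not_ge (hle n)

lemma ae_monotone_renewalTime (h : IsRenewalSequence P A x₀ τ κ) (hten : Tenable A x₀) :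
    ∀ᵐ ω ∂P, Monotone fun n => renewalTime τ n ω := by
  filter_upwards [ae_all_iff.2 fun n => h.ae_waiting_pos hten n] with ω hpos
  refine monotone_nat_of_le_succ fun n => ?_
  rw [renewalTime_succ]
  exact le_add_of_nonneg_right (hpos n).le

end IsRenewalSequence

end NonExplosion

section BackwardEquation

variable {c : ℕ} {A : Matrix (Fin c) (Fin c) ℝ} {x₀ : Fin c → ℝ} {T : ℝ}
  {u : ℝ → (Fin c → ℝ) → ℝ}

/-- `u` is a nonnegative solution on `[0, T]` of the Kolmogorov backward equation of the walk with
navigation matrix `A`: `u t z` is a candidate for the expectation at time `t` of `u 0` along the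
walk started at `z`. The equation is required only at the positions that can be reached from
`x₀`. -/
structure IsBackwardSolution (A : Matrix (Fin c) (Fin c) ℝ) (x₀ : Fin c → ℝ) (T : ℝ)
    (u : ℝ → (Fin c → ℝ) → ℝ) : Prop where
  measurable : Measurable fun p : ℝ × (Fin c → ℝ) => u p.1 p.2
  nonneg : ∀ z, Reachable A x₀ z → ∀ t ∈ Set.Icc 0 T, 0 ≤ u t z
  hasDerivAt : ∀ z, Reachable A x₀ z → ∀ t ∈ Set.Icc 0 T,
    HasDerivAt (fun t => u t z) (∑ i, z i * (u t (z + A i) - u t z)) t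

/-- The value that `u` predicts at time `T` for the walk started at `z`, once the waiting time `r`
and the colour `i` of the first renewal are known. -/
noncomputable def firstStepValue (A : Matrix (Fin c) (Fin c) ℝ) (u : ℝ → (Fin c → ℝ) → ℝ)
    (T : ℝ) (z : Fin c → ℝ) (r : ℝ) (i : Fin c) : ℝ :=
  if r ≤ T then u (T - r) (z + A i) else u 0 z

namespace IsBackwardSolution

lemma mono (hu : IsBackwardSolution A x₀ T u) {T' : ℝ} (hT : T' ≤ T) :
    IsBackwardSolution A x₀ T' u where
  measurable := hu.measurable
  nonneg z hz t ht := hu.nonneg z hz t ⟨ht.1, ht.2.trans hT⟩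
  hasDerivAt z hz t ht := hu.hasDerivAt z hz t ⟨ht.1, ht.2.trans hT⟩

lemma hasDerivAt_neg_exp_mul (hu : IsBackwardSolution A x₀ T u) {z : Fin c → ℝ}
    (hz : Reachable A x₀ z) {r : ℝ} (hr : r ∈ Set.Icc 0 T) :
    HasDerivAt (fun r => -(Real.exp (-(r * ∑ j, z j)) * u (T - r) z))
      (∑ i, z i * Real.exp (-(r * ∑ j, z j)) * u (T - r) (z + A i)) r := by
  have hexp : HasDerivAt (fun r => Real.exp (-(r * ∑ j, z j)))
      (Real.exp (-(r * ∑ j, z j)) * -∑ j, z j) r := by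
    simpa using ((hasDerivAt_id r).mul_const (∑ j, z j)).neg.exp
  have hu' := HasDerivAt.comp_const_sub T r
    (hu.hasDerivAt z hz (T - r) ⟨sub_nonneg.2 hr.2, sub_le_self _ hr.1⟩)
  refine (hexp.mul hu').neg.congr_deriv ?_
  simp only [mul_sub, Finset.sum_sub_distrib, ← Finset.sum_mul, mul_right_comm _ (Real.exp _)]
  ring

lemma jumpDensity_mul_nonneg (hu : IsBackwardSolution A x₀ T u) (hten : Tenable A x₀)
    {z : Fin c → ℝ} (hz : Reachable A x₀ z) (i : Fin c) {r : ℝ} (hr : r ∈ Set.Icc 0 T) :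
    0 ≤ z i * Real.exp (-(r * ∑ j, z j)) * u (T - r) (z + A i) := by
  rcases ((hten z hz).1 i).eq_or_lt with hi | hi
  · simp [← hi]
  · have := hu.nonneg _ (hz.step i hi) (T - r) ⟨sub_nonneg.2 hr.2, sub_le_self _ hr.1⟩
    positivity

lemma integrableOn_sum_jumpDensity_mul (hu : IsBackwardSolution A x₀ T u) (hten : Tenable A x₀)
    {z : Fin c → ℝ} (hz : Reachable A x₀ z) :
    IntegrableOn (fun r => ∑ i, z i * Real.exp (-(r * ∑ j, z j)) * u (T - r) (z + A i))
      (Set.Ioc 0 T) :=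
  intervalIntegral.integrableOn_deriv_of_nonneg
    (HasDerivAt.continuousOn fun _ hr => hu.hasDerivAt_neg_exp_mul hz hr)
    (fun _ hr => hu.hasDerivAt_neg_exp_mul hz (Set.Ioo_subset_Icc_self hr))
    fun _ hr => Finset.sum_nonneg fun i _ =>
      hu.jumpDensity_mul_nonneg hten hz i (Set.Ioo_subset_Icc_self hr)

lemma integral_sum_jumpDensity_mul (hu : IsBackwardSolution A x₀ T u) (hten : Tenable A x₀)
    (hT : 0 ≤ T) {z : Fin c → ℝ} (hz : Reachable A x₀ z) :
    ∫ r in Set.Ioc 0 T, ∑ i, z i * Real.exp (-(r * ∑ j, z j)) * u (T - r) (z + A i) =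
      u T z - Real.exp (-(T * ∑ j, z j)) * u 0 z := by
  rw [← intervalIntegral.integral_of_le hT, intervalIntegral.integral_eq_sub_of_hasDerivAt_of_le hT
    (HasDerivAt.continuousOn fun _ hr => hu.hasDerivAt_neg_exp_mul hz hr)
    (fun _ hr => hu.hasDerivAt_neg_exp_mul hz (Set.Ioo_subset_Icc_self hr))
    ((intervalIntegrable_iff_integrableOn_Ioc_of_le hT).2
      (hu.integrableOn_sum_jumpDensity_mul hten hz))]
  simp only [sub_self, sub_zero, zero_mul, neg_zero, Real.exp_zero, one_mul]
  ring

lemma sum_lintegral_Ioc_jumpDensity_mul_add (hu : IsBackwardSolution A x₀ T u)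
    (hten : Tenable A x₀) (hT : 0 ≤ T) {z : Fin c → ℝ} (hz : Reachable A x₀ z) :
    (∑ i, ∫⁻ r in Set.Ioc 0 T, jumpDensity z i r * ENNReal.ofReal (u (T - r) (z + A i))) +
        ENNReal.ofReal (Real.exp (-(T * ∑ j, z j)) * u 0 z) =
      ENNReal.ofReal (u T z) := by
  have hnonneg : ∀ r ∈ Set.Ioc 0 T, ∀ i, 0 ≤ z i * Real.exp (-(r * ∑ j, z j)) *
      u (T - r) (z + A i) := fun r hr i =>
    hu.jumpDensity_mul_nonneg hten hz i (Set.Ioc_subset_Icc_self hr)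
  have hmeas (i : Fin c) :
      Measurable fun r => jumpDensity z i r * ENNReal.ofReal (u (T - r) (z + A i)) := by
    have := hu.measurable.comp (by fun_prop : Measurable fun r => (T - r, z + A i))
    unfold jumpDensity
    exact Measurable.mul (by fun_prop) this.ennreal_ofReal
  calc (∑ i, ∫⁻ r in Set.Ioc 0 T, jumpDensity z i r * ENNReal.ofReal (u (T - r) (z + A i))) +
        ENNReal.ofReal (Real.exp (-(T * ∑ j, z j)) * u 0 z)
      = (∫⁻ r in Set.Ioc 0 T, ENNReal.ofReal
          (∑ i, z i * Real.exp (-(r * ∑ j, z j)) * u (T - r) (z + A i))) +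
        ENNReal.ofReal (Real.exp (-(T * ∑ j, z j)) * u 0 z) := by
        rw [← lintegral_finsetSum _ fun i _ => hmeas i]
        congr 1
        refine setLIntegral_congr_fun measurableSet_Ioc fun r hr => ?_
        rw [ENNReal.ofReal_sum_of_nonneg fun i _ => hnonneg r hr i]
        exact Finset.sum_congr rfl fun i _ =>
          (ENNReal.ofReal_mul (mul_nonneg ((hten z hz).1 i) (Real.exp_pos _).le)).symm
    _ = ENNReal.ofReal (u T z) := by
        rw [← ofReal_integral_eq_lintegral_ofReal (hu.integrableOn_sum_jumpDensity_mul hten hz) <|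
            (ae_restrict_mem measurableSet_Ioc).mono fun r hr =>
              Finset.sum_nonneg fun i _ => hnonneg r hr i,
          ← ENNReal.ofReal_add (setIntegral_nonneg measurableSet_Ioc fun r hr =>
              Finset.sum_nonneg fun i _ => hnonneg r hr i)
            (mul_nonneg (Real.exp_pos _).le (hu.nonneg z hz 0 ⟨le_rfl, hT⟩)),
          hu.integral_sum_jumpDensity_mul hten hT hz, sub_add_cancel]

lemma sum_lintegral_jumpDensity_mul_firstStepValue (hu : IsBackwardSolution A x₀ T u)
    (hten : Tenable A x₀) (hT : 0 ≤ T) {z : Fin c → ℝ} (hz : Reachable A x₀ z) :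
    ∑ i, ∫⁻ r in Set.Ioi 0, jumpDensity z i r *
        ENNReal.ofReal (firstStepValue A u T z r i) =
      ENNReal.ofReal (u T z) := by
  obtain ⟨hnonneg, hsum⟩ := hten.nonneg_and_sum_pos hz
  have hu0 := hu.nonneg z hz 0 ⟨le_rfl, hT⟩
  have hlate (i : Fin c) : ∫⁻ r in Set.Ioi T, jumpDensity z i r *
        ENNReal.ofReal (firstStepValue A u T z r i) =
      ENNReal.ofReal (Real.exp (-(T * ∑ j, z j)) * u 0 z * (z i / ∑ j, z j)) := by
    rw [setLIntegral_congr_fun (g := fun r => jumpDensity z i r * ENNReal.ofReal (u 0 z))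
        measurableSet_Ioi fun r (hr : T < r) => by simp only [firstStepValue, if_neg hr.not_ge],
      lintegral_mul_const' _ _ ENNReal.ofReal_ne_top,
      lintegral_Ioi_jumpDensity i (hnonneg i) hsum, ← ENNReal.ofReal_mul, mul_right_comm]
    exact mul_nonneg (Real.exp_pos _).le (div_nonneg (hnonneg i) hsum.le)
  have hearly (i : Fin c) : ∫⁻ r in Set.Ioc 0 T, jumpDensity z i r *
        ENNReal.ofReal (firstStepValue A u T z r i) =
      ∫⁻ r in Set.Ioc 0 T, jumpDensity z i r * ENNReal.ofReal (u (T - r) (z + A i)) :=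
    setLIntegral_congr_fun measurableSet_Ioc fun r hr => by simp only [firstStepValue, if_pos hr.2]
  simp_rw [← Set.Ioc_union_Ioi_eq_Ioi hT,
    lintegral_union measurableSet_Ioi (Set.Ioc_disjoint_Ioi le_rfl), hearly, hlate]
  rw [Finset.sum_add_distrib, ← ENNReal.ofReal_sum_of_nonneg fun i _ =>
      mul_nonneg (mul_nonneg (Real.exp_pos _).le hu0) (div_nonneg (hnonneg i) hsum.le),
    ← Finset.mul_sum, ← Finset.sum_div, div_self hsum.ne', mul_one,
    hu.sum_lintegral_Ioc_jumpDensity_mul_add hten hT hz]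

lemma measurable_firstStepValue (hu : IsBackwardSolution A x₀ T u) (t : ℝ) (i : Fin c) :
    Measurable fun p : (ℝ × (Fin c → ℝ)) × ℝ => firstStepValue A u (t - p.1.1) p.1.2 p.2 i :=
  Measurable.ite (measurableSet_le (by fun_prop) (by fun_prop))
    (hu.measurable.comp (by fun_prop : Measurable
      fun p : (ℝ × (Fin c → ℝ)) × ℝ => (t - p.1.1 - p.2, p.1.2 + A i)))
    (hu.measurable.comp (by fun_prop : Measurable
      fun p : (ℝ × (Fin c → ℝ)) × ℝ => ((0 : ℝ), p.1.2)))

end IsBackwardSolution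

/-- The expectation of `u 0 (X t)` given the first `n` renewals, as predicted by a solution `u` of
the backward equation. -/
noncomputable def backwardMartingale {Ω : Type*} (A : Matrix (Fin c) (Fin c) ℝ) (x₀ : Fin c → ℝ)
    (τ : ℕ → Ω → ℝ) (κ : ℕ → Ω → Fin c) (X : ℝ≥0 → Ω → Fin c → ℝ) (u : ℝ → (Fin c → ℝ) → ℝ)
    (t : ℝ≥0) (n : ℕ) (ω : Ω) : ℝ :=
  if renewalTime τ n ω ≤ t then u (t - renewalTime τ n ω) (position A x₀ κ n ω) else u 0 (X t ω)

variable {Ω : Type*} {τ : ℕ → Ω → ℝ} {κ : ℕ → Ω → Fin c} {X : ℝ≥0 → Ω → Fin c → ℝ} {t : ℝ≥0}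

lemma backwardMartingale_succ {n : ℕ} {ω : Ω}
    (hX : t < renewalTime τ (n + 1) ω → X t ω = position A x₀ κ n ω) :
    backwardMartingale A x₀ τ κ X u t (n + 1) ω =
      firstStepValue A u (t - renewalTime τ n ω) (position A x₀ κ n ω) (τ n ω) (κ n ω) := by
  unfold backwardMartingale firstStepValue
  rw [renewalTime_succ] at hX ⊢
  simp only [le_sub_iff_add_le', sub_sub, position_succ]
  split_ifs with hsucc
  · rfl
  · rw [hX (not_le.1 hsucc)]

variable [MeasurableSpace Ω] {P : Measure Ω} [IsProbabilityMeasure P]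

namespace IsRenewalSequence

lemma setLIntegral_backwardMartingale_succ (h : IsRenewalSequence P A x₀ τ κ)
    (hten : Tenable A x₀) (hu : IsBackwardSolution A x₀ t u)
    (hX : ∀ᵐ ω ∂P, ∀ n, renewalTime τ n ω ≤ t → t < renewalTime τ (n + 1) ω →
      X t ω = position A x₀ κ n ω) (n : ℕ) :
    ∫⁻ ω in {ω | renewalTime τ n ω ≤ t},
        ENNReal.ofReal (backwardMartingale A x₀ τ κ X u t (n + 1) ω) ∂P =
      ∫⁻ ω in {ω | renewalTime τ n ω ≤ t},
        ENNReal.ofReal (backwardMartingale A x₀ τ κ X u t n ω) ∂P := by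
  have hS : MeasurableSet {ω | renewalTime τ n ω ≤ t} :=
    measurableSet_le (h.measurable_renewalTime n) measurable_const
  let f (T : ℝ) (z : Fin c → ℝ) (r : ℝ) (i : Fin c) : ENNReal :=
    if T ≤ t then ENNReal.ofReal (firstStepValue A u (t - T) z r i) else 0
  have hf (i : Fin c) : Measurable fun p : (ℝ × (Fin c → ℝ)) × ℝ => f p.1.1 p.1.2 p.2 i :=
    Measurable.ite (measurableSet_le (by fun_prop) (by fun_prop))
      (hu.measurable_firstStepValue t i).ennreal_ofReal measurable_const
  rw [← lintegral_indicator hS, ← lintegral_indicator hS]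
  calc ∫⁻ ω, {ω | renewalTime τ n ω ≤ t}.indicator
          (fun ω => ENNReal.ofReal (backwardMartingale A x₀ τ κ X u t (n + 1) ω)) ω ∂P
      = ∫⁻ ω, f (renewalTime τ n ω) (position A x₀ κ n ω) (τ n ω) (κ n ω) ∂P := by
        refine lintegral_congr_ae ?_
        filter_upwards [hX] with ω hω
        by_cases hn : renewalTime τ n ω ≤ t
        · simp [f, hn, backwardMartingale_succ (hω n hn)]
        · simp [f, hn]
    _ = ∫⁻ ω, {ω | renewalTime τ n ω ≤ t}.indicator
          (fun ω => ENNReal.ofReal (backwardMartingale A x₀ τ κ X u t n ω)) ω ∂P := by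
        rw [h.lintegral_next hten n hf]
        refine lintegral_congr_ae ?_
        filter_upwards [h.ae_reachable hten n, h.ae_monotone_renewalTime hten] with ω hreach hmono
        by_cases hn : renewalTime τ n ω ≤ t
        · have hT : 0 ≤ renewalTime τ n ω := (renewalTime_zero ω).symm.trans_le (hmono n.zero_le)
          simpa [f, backwardMartingale, hn] using (hu.mono
            (sub_le_self _ hT)).sum_lintegral_jumpDensity_mul_firstStepValue hten
              (sub_nonneg.2 hn) hreach
        · simp [f, hn]

lemma lintegral_backwardMartingale (h : IsRenewalSequence P A x₀ τ κ)
    (hten : Tenable A x₀) (hu : IsBackwardSolution A x₀ t u)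
    (hX : ∀ᵐ ω ∂P, ∀ n, renewalTime τ n ω ≤ t → t < renewalTime τ (n + 1) ω →
      X t ω = position A x₀ κ n ω) (n : ℕ) :
    ∫⁻ ω, ENNReal.ofReal (backwardMartingale A x₀ τ κ X u t n ω) ∂P = ENNReal.ofReal (u t x₀) := by
  induction n with
  | zero => simp [backwardMartingale, renewalTime_zero, position_zero]
  | succ n ih =>
    have hS : MeasurableSet {ω | renewalTime τ n ω ≤ t} :=
      measurableSet_le (h.measurable_renewalTime n) measurable_const
    refine (lintegral_add_compl _ hS).symm.trans (Eq.trans ?_ ((lintegral_add_compl _ hS).trans ih))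
    rw [h.setLIntegral_backwardMartingale_succ hten hu hX n]
    congr 1
    refine setLIntegral_congr_fun_ae hS.compl ?_
    filter_upwards [h.ae_monotone_renewalTime hten] with ω hmono hn
    have hsucc : ¬renewalTime τ (n + 1) ω ≤ t := fun hle => hn ((hmono n.le_succ).trans hle)
    simp only [backwardMartingale, if_neg hsucc, if_neg (show ¬renewalTime τ n ω ≤ t from hn)]

omit [IsProbabilityMeasure P] in
lemma aemeasurable_backwardMartingale (h : IsRenewalSequence P A x₀ τ κ)
    (hu : IsBackwardSolution A x₀ T u) (hX : AEMeasurable (X t) P) (n : ℕ) :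
    AEMeasurable (backwardMartingale A x₀ τ κ X u t n) P := by
  have hT := h.measurable_renewalTime n
  have hpos := h.measurable_position n
  have hpast := hu.measurable.comp
    (by fun_prop : Measurable fun ω => (t - renewalTime τ n ω, position A x₀ κ n ω))
  have hend := hu.measurable.comp (measurable_const (a := (0 : ℝ)) |>.prodMk hX.measurable_mk)
  refine ⟨backwardMartingale A x₀ τ κ (fun _ => hX.mk _) u t n,
    Measurable.ite (measurableSet_le hT measurable_const) hpast hend, ?_⟩
  filter_upwards [hX.ae_eq_mk] with ω hω
  simp only [backwardMartingale, hω]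

lemma ae_tendsto_backwardMartingale (h : IsRenewalSequence P A x₀ τ κ)
    (hten : Tenable A x₀) (X : ℝ≥0 → Ω → Fin c → ℝ) (u : ℝ → (Fin c → ℝ) → ℝ) (t : ℝ≥0) :
    ∀ᵐ ω ∂P, Tendsto (fun n => ENNReal.ofReal (backwardMartingale A x₀ τ κ X u t n ω)) atTop
      (𝓝 (ENNReal.ofReal (u 0 (X t ω)))) := by
  filter_upwards [h.ae_exists_lt_renewalTime hten t, h.ae_monotone_renewalTime hten]
    with ω ⟨n, hn⟩ hmono
  refine tendsto_atTop_of_eventually_const (i₀ := n) fun m hm => ?_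
  rw [backwardMartingale, if_neg (hn.trans_le (hmono hm)).not_ge]

end IsRenewalSequence

namespace IsContinuumPolyaWalk

lemma aemeasurable (hX : IsContinuumPolyaWalk P A x₀ X) (hten : Tenable A x₀) (t : ℝ≥0) :
    AEMeasurable (X t) P := by
  obtain ⟨τ, κ, h, hXpos⟩ := hX
  let S (n : ℕ) : Set Ω := {ω | renewalTime τ n ω ≤ t ∧ t < renewalTime τ (n + 1) ω}
  have hS (n : ℕ) : MeasurableSet (S n) :=
    (measurableSet_le (h.measurable_renewalTime n) measurable_const).inter
      (measurableSet_lt measurable_const (h.measurable_renewalTime (n + 1)))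
  have hcover : P.restrict (⋃ n, S n) = P := Measure.restrict_eq_self_of_ae_mem <|
    (h.ae_exists_renewalTime_le_lt hten t).mono fun ω hω => Set.mem_iUnion.2 hω
  rw [← hcover, aemeasurable_iUnion_iff]
  refine fun n => (h.measurable_position n).aemeasurable.congr ?_
  filter_upwards [ae_restrict_mem (hS n), ae_restrict_of_ae hXpos] with ω hω hωX
  exact (hωX n t hω.1 hω.2).symm

lemma ae_reachable (hX : IsContinuumPolyaWalk P A x₀ X) (hten : Tenable A x₀) (t : ℝ≥0) :
    ∀ᵐ ω ∂P, Reachable A x₀ (X t ω) := by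
  obtain ⟨τ, κ, h, hXpos⟩ := hX
  filter_upwards [hXpos, h.ae_exists_renewalTime_le_lt hten t,
    ae_all_iff.2 fun n => h.ae_reachable hten n] with ω hω ⟨n, hle, hlt⟩ hreach
  rw [hω n t hle hlt]
  exact hreach n

variable (hX : IsContinuumPolyaWalk P A x₀ X) (hten : Tenable A x₀)
include hX hten

theorem lintegral_backwardSolution_le (hu : IsBackwardSolution A x₀ t u) :
    ∫⁻ ω, ENNReal.ofReal (u 0 (X t ω)) ∂P ≤ ENNReal.ofReal (u t x₀) := by
  have hXt := hX.aemeasurable hten t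
  obtain ⟨τ, κ, h, hXpos⟩ := hX
  calc ∫⁻ ω, ENNReal.ofReal (u 0 (X t ω)) ∂P
      = ∫⁻ ω, liminf (fun n => ENNReal.ofReal (backwardMartingale A x₀ τ κ X u t n ω)) atTop ∂P :=
        lintegral_congr_ae <| (h.ae_tendsto_backwardMartingale hten X u t).mono fun ω hω =>
          hω.liminf_eq.symm
    _ ≤ liminf (fun n => ∫⁻ ω, ENNReal.ofReal (backwardMartingale A x₀ τ κ X u t n ω) ∂P) atTop :=
        lintegral_liminf_le' fun n => (h.aemeasurable_backwardMartingale hu hXt n).ennreal_ofReal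
    _ = ENNReal.ofReal (u t x₀) := by
        simp_rw [h.lintegral_backwardMartingale hten hu
          (hXpos.mono fun _ hω n => hω n t), liminf_const]

theorem lintegral_backwardSolution_eq (hu : IsBackwardSolution A x₀ t u) {C : ℝ}
    (hC : ∀ z, Reachable A x₀ z → ∀ s ∈ Set.Icc (0 : ℝ) t, u s z ≤ C) :
    ∫⁻ ω, ENNReal.ofReal (u 0 (X t ω)) ∂P = ENNReal.ofReal (u t x₀) := by
  have hXt := hX.aemeasurable hten t
  have hreachX := hX.ae_reachable hten t
  obtain ⟨τ, κ, h, hXpos⟩ := hX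
  have hbound (n : ℕ) : (fun ω => ENNReal.ofReal (backwardMartingale A x₀ τ κ X u t n ω)) ≤ᵐ[P]
      fun _ => ENNReal.ofReal C := by
    filter_upwards [hreachX, h.ae_reachable hten n, h.ae_monotone_renewalTime hten]
      with ω hreachX hreach hmono
    refine ENNReal.ofReal_le_ofReal ?_
    unfold backwardMartingale
    split_ifs with hn
    · exact hC _ hreach _ ⟨sub_nonneg.2 hn,
        sub_le_self _ ((renewalTime_zero ω).symm.trans_le (hmono n.zero_le))⟩
    · exact hC _ hreachX 0 ⟨le_rfl, t.coe_nonneg⟩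
  have hlim := tendsto_lintegral_of_dominated_convergence' _
    (fun n => (h.aemeasurable_backwardMartingale hu hXt n).ennreal_ofReal) hbound (by simp)
    (h.ae_tendsto_backwardMartingale hten X u t)
  simp_rw [h.lintegral_backwardMartingale hten hu (hXpos.mono fun _ hω n => hω n t)] at hlim
  exact tendsto_nhds_unique hlim tendsto_const_nhds

lemma integrable_backwardSolution (hu : IsBackwardSolution A x₀ t u) :
    Integrable (fun ω => u 0 (X t ω)) P := by
  have hmeas := hu.measurable.comp_aemeasurable
    (aemeasurable_const (b := (0 : ℝ)) |>.prodMk (hX.aemeasurable hten t))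
  refine (lintegral_ofReal_ne_top_iff_integrable hmeas.aestronglyMeasurable ?_).1
    ((hX.lintegral_backwardSolution_le hten hu).trans_lt ENNReal.ofReal_lt_top).ne
  exact (hX.ae_reachable hten t).mono fun ω hω => hu.nonneg _ hω 0 ⟨le_rfl, t.coe_nonneg⟩

theorem integral_backwardSolution (hu : IsBackwardSolution A x₀ t u) {C : ℝ}
    (hC : ∀ z, Reachable A x₀ z → ∀ s ∈ Set.Icc (0 : ℝ) t, u s z ≤ C) :
    ∫ ω, u 0 (X t ω) ∂P = u t x₀ := by
  have hnonneg : 0 ≤ᵐ[P] fun ω => u 0 (X t ω) :=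
    (hX.ae_reachable hten t).mono fun ω hω => hu.nonneg _ hω 0 ⟨le_rfl, t.coe_nonneg⟩
  rw [integral_eq_lintegral_of_nonneg_ae hnonneg
      (hX.integrable_backwardSolution hten hu).aestronglyMeasurable,
    hX.lintegral_backwardSolution_eq hten hu hC,
    ENNReal.toReal_ofReal (hu.nonneg _ .start t ⟨t.coe_nonneg, le_rfl⟩)]

end IsContinuumPolyaWalk

end BackwardEquation

section ReflectingWalk

/-- The navigation matrix of the paper: the two colours of renewal move both coordinates by `-γ`
and by `γ`, respectively. -/
abbrev navigation (γ : ℝ) : Matrix (Fin 2) (Fin 2) ℝ := !![-γ, -γ; γ, γ]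

/-- The expectation of `w ^ (X t 0 / γ)` along the walk started at `z`. -/
noncomputable def genFun (γ w t : ℝ) (z : Fin 2 → ℝ) : ℝ :=
  (w - γ * t * (w - 1)) ^ (z 0 / γ) / (1 - γ * t * (w - 1)) ^ (z 1 / γ)

variable {γ w t : ℝ}

lemma one_sub_mul_pos {T : ℝ} (hγ : 0 < γ) (hT : γ * T * (w - 1) < 1) (ht : t ∈ Set.Icc 0 T) :
    0 < 1 - γ * t * (w - 1) := by
  rcases le_total (w - 1) 0 with hw | hw
  · nlinarith [mul_nonneg hγ.le ht.1]
  · nlinarith [mul_le_mul_of_nonneg_left ht.2 (mul_nonneg hγ.le hw)]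

lemma sub_mul_pos (hγ : 0 < γ) (ht : 0 ≤ t) (hw : 0 < w) (hD : 0 < 1 - γ * t * (w - 1)) :
    0 < w - γ * t * (w - 1) := by
  rcases le_total (w - 1) 0 with h | h
  · nlinarith [mul_nonneg hγ.le ht]
  · linarith

lemma genFun_nonneg (hD : 0 ≤ 1 - γ * t * (w - 1)) (hN : 0 ≤ w - γ * t * (w - 1))
    (z : Fin 2 → ℝ) : 0 ≤ genFun γ w t z := by
  unfold genFun
  positivity

lemma genFun_zero (γ w : ℝ) (z : Fin 2 → ℝ) : genFun γ w 0 z = w ^ (z 0 / γ) := by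
  simp [genFun]

lemma genFun_exp_zero (hγ : γ ≠ 0) (u : ℝ) (z : Fin 2 → ℝ) :
    genFun γ (Real.exp (γ * u)) 0 z = Real.exp (u * z 0) := by
  rw [genFun_zero, ← Real.exp_mul]
  congr 1
  field_simp

lemma measurable_genFun (γ w : ℝ) : Measurable fun p : ℝ × (Fin 2 → ℝ) => genFun γ w p.1 p.2 := by
  unfold genFun
  fun_prop

lemma genFun_add_row_zero (hγ : γ ≠ 0) (hD : 0 < 1 - γ * t * (w - 1))
    (hN : 0 < w - γ * t * (w - 1)) (z : Fin 2 → ℝ) :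
    genFun γ w t (z + navigation γ 0) =
      genFun γ w t z * ((1 - γ * t * (w - 1)) / (w - γ * t * (w - 1))) := by
  have h (x : ℝ) : (x + -γ) / γ = x / γ - 1 := by field_simp; ring
  simp only [genFun, Pi.add_apply, Matrix.of_apply, Matrix.cons_val', Matrix.cons_val_zero,
    Matrix.cons_val_one, h, Real.rpow_sub_one hD.ne', Real.rpow_sub_one hN.ne']
  have := Real.rpow_pos_of_pos hD (z 1 / γ)
  field_simp

lemma genFun_add_row_one (hγ : γ ≠ 0) (hD : 0 < 1 - γ * t * (w - 1))
    (hN : 0 < w - γ * t * (w - 1)) (z : Fin 2 → ℝ) :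
    genFun γ w t (z + navigation γ 1) =
      genFun γ w t z * ((w - γ * t * (w - 1)) / (1 - γ * t * (w - 1))) := by
  have h (x : ℝ) : (x + γ) / γ = x / γ + 1 := by field_simp
  simp only [genFun, Pi.add_apply, Matrix.of_apply, Matrix.cons_val', Matrix.cons_val_zero,
    Matrix.cons_val_one, h, Real.rpow_add_one hD.ne', Real.rpow_add_one hN.ne']
  have := Real.rpow_pos_of_pos hD (z 1 / γ)
  field_simp

lemma hasDerivAt_genFun (hγ : γ ≠ 0) (hD : 0 < 1 - γ * t * (w - 1))
    (hN : 0 < w - γ * t * (w - 1)) (z : Fin 2 → ℝ) :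
    HasDerivAt (fun t => genFun γ w t z)
      (∑ i, z i * (genFun γ w t (z + navigation γ i) - genFun γ w t z)) t := by
  have hlin : HasDerivAt (fun t => γ * t * (w - 1)) (γ * (w - 1)) t := by
    simpa using ((hasDerivAt_id t).const_mul γ).mul_const (w - 1)
  have hpow := Real.rpow_pos_of_pos hD (z 1 / γ)
  refine (((hlin.const_sub w).rpow_const (p := z 0 / γ) (.inl hN.ne')).div
    ((hlin.const_sub 1).rpow_const (p := z 1 / γ) (.inl hD.ne')) hpow.ne').congr_deriv ?_
  rw [Fin.sum_univ_two, genFun_add_row_zero hγ hD hN, genFun_add_row_one hγ hD hN, genFun,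
    Real.rpow_sub_one hD.ne', Real.rpow_sub_one hN.ne']
  have hslope : γ * (w - 1) = γ * ((w - γ * t * (w - 1)) - (1 - γ * t * (w - 1))) := by ring
  rw [hslope]
  generalize w - γ * t * (w - 1) = N, 1 - γ * t * (w - 1) = D at *
  have hD' := hD.ne'
  have hN' := hN.ne'
  field_simp
  ring

lemma isBackwardSolution_genFun (hγ : 0 < γ) (hw : 0 < w) {T : ℝ} (hT : γ * T * (w - 1) < 1)
    (x₀ : Fin 2 → ℝ) : IsBackwardSolution (navigation γ) x₀ T (genFun γ w) where
  measurable := measurable_genFun γ w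
  nonneg z _ _ ht :=
    have hD := one_sub_mul_pos hγ hT ht
    genFun_nonneg hD.le (sub_mul_pos hγ ht.1 hw hD).le z
  hasDerivAt z _ _ ht :=
    have hD := one_sub_mul_pos hγ hT ht
    hasDerivAt_genFun hγ.ne' hD (sub_mul_pos hγ ht.1 hw hD) z

lemma genFun_le_one (hγ : 0 ≤ γ) (hw : 0 ≤ w) (hw1 : w ≤ 1) (ht : 0 ≤ t)
    {z : Fin 2 → ℝ} (hz0 : 0 ≤ z 0) (hz : z 0 ≤ z 1) : genFun γ w t z ≤ 1 := by
  have hD : 1 ≤ 1 - γ * t * (w - 1) := by nlinarith [mul_nonneg hγ ht]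
  have hN : 0 ≤ w - γ * t * (w - 1) := by linarith
  refine div_le_one_of_le₀ ?_ (by positivity)
  calc (w - γ * t * (w - 1)) ^ (z 0 / γ) ≤ (1 - γ * t * (w - 1)) ^ (z 0 / γ) :=
        Real.rpow_le_rpow hN (by linarith) (by positivity)
    _ ≤ (1 - γ * t * (w - 1)) ^ (z 1 / γ) := Real.rpow_le_rpow_of_exponent_le hD (by gcongr)

lemma genFun_eq_mul_div_rpow (hD : 0 < 1 - γ * t * (w - 1)) (hN : 0 ≤ w - γ * t * (w - 1))
    (x y : ℝ) : genFun γ w t ![x, y] = 1 / (1 - γ * t * (w - 1)) ^ ((y - x) / γ) *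
      ((w - γ * t * (w - 1)) / (1 - γ * t * (w - 1))) ^ (x / γ) := by
  simp only [genFun, Matrix.cons_val_zero, Matrix.cons_val_one]
  rw [Real.div_rpow hN hD.le, div_mul_div_comm, one_mul, ← Real.rpow_add hD, ← add_div,
    sub_add_cancel]

lemma analyticAt_genFun_exp {u : ℝ} (hD : 0 < 1 - γ * t * (Real.exp (γ * u) - 1))
    (hN : 0 < Real.exp (γ * u) - γ * t * (Real.exp (γ * u) - 1)) (z : Fin 2 → ℝ) :
    AnalyticAt ℝ (fun u => genFun γ (Real.exp (γ * u)) t z) u := by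
  have hpow := Real.rpow_pos_of_pos hD (z 1 / γ)
  refine ContDiffAt.analyticAt (ContDiffAt.div ?_ ?_ hpow.ne')
  · exact ContDiffAt.rpow_const_of_ne (by fun_prop) hN.ne'
  · exact ContDiffAt.rpow_const_of_ne (by fun_prop) hD.ne'

lemma Reachable.one_sub_zero_eq {x₀ z : Fin 2 → ℝ} (hz : Reachable (navigation γ) x₀ z) :
    z 1 - z 0 = x₀ 1 - x₀ 0 := by
  induction hz with
  | start => rfl
  | step i _ _ ih => fin_cases i <;> simpa [navigation] using ih

/-- The exponents at which the moment generating function of the first coordinate is finite at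
time `t`. -/
def admissibleSet (γ t : ℝ) : Set ℝ := {u | γ * t * (Real.exp (γ * u) - 1) < 1}

lemma isOpen_admissibleSet (γ t : ℝ) : IsOpen (admissibleSet γ t) :=
  isOpen_lt (by fun_prop) continuous_const

lemma mem_admissibleSet_of_nonpos (hγ : 0 ≤ γ) (ht : 0 ≤ t) {u : ℝ} (hu : u ≤ 0) :
    u ∈ admissibleSet γ t := by
  have hexp : Real.exp (γ * u) - 1 ≤ 0 :=
    sub_nonpos.2 (Real.exp_le_one_iff.2 (mul_nonpos_of_nonneg_of_nonpos hγ hu))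
  exact (mul_nonpos_of_nonneg_of_nonpos (mul_nonneg hγ ht) hexp).trans_lt one_pos

lemma isPreconnected_admissibleSet (hγ : 0 ≤ γ) (ht : 0 ≤ t) :
    IsPreconnected (admissibleSet γ t) := by
  have hlower : IsLowerSet (admissibleSet γ t) := fun u v hvu (hu : _ < _) =>
    (by gcongr : γ * t * (Real.exp (γ * v) - 1) ≤ γ * t * (Real.exp (γ * u) - 1)).trans_lt hu
  exact hlower.ordConnected.isPreconnected

end ReflectingWalk

namespace IsContinuumPolyaWalk

variable {γ : ℝ} {x₀ : Fin 2 → ℝ} {t : ℝ≥0} {Ω : Type*} {X : ℝ≥0 → Ω → Fin 2 → ℝ}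
  [MeasurableSpace Ω] {P : Measure Ω} [IsProbabilityMeasure P]
  (hX : IsContinuumPolyaWalk P (navigation γ) x₀ X) (hten : Tenable (navigation γ) x₀)
include hX hten

lemma ae_snd_eq_fst_add (t : ℝ≥0) : ∀ᵐ ω ∂P, X t ω 1 = X t ω 0 + (x₀ 1 - x₀ 0) :=
  (hX.ae_reachable hten t).mono fun _ hω => by linarith [hω.one_sub_zero_eq]

lemma ae_fst_nonneg (t : ℝ≥0) : ∀ᵐ ω ∂P, 0 ≤ X t ω 0 :=
  (hX.ae_reachable hten t).mono fun _ hω => (hten _ hω).1 0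

variable (hγ : 0 < γ)
include hγ

lemma integrable_exp_mul_fst {u : ℝ} (hu : u ∈ admissibleSet γ t) :
    Integrable (fun ω => Real.exp (u * X t ω 0)) P := by
  simpa only [genFun_exp_zero hγ.ne'] using hX.integrable_backwardSolution hten
    (isBackwardSolution_genFun hγ (Real.exp_pos _) hu x₀)

lemma mgf_fst_of_nonpos (hx : x₀ 0 ≤ x₀ 1) {u : ℝ} (hu : u ≤ 0) :
    mgf (fun ω => X t ω 0) P u = genFun γ (Real.exp (γ * u)) t x₀ := by
  rw [← hX.integral_backwardSolution hten (isBackwardSolution_genFun hγ (Real.exp_pos _)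
    (mem_admissibleSet_of_nonpos hγ.le t.coe_nonneg hu) x₀) (C := 1)]
  · simp only [genFun_exp_zero hγ.ne', mgf]
  · intro z hz s hs
    exact genFun_le_one hγ.le (Real.exp_pos _).le
      (Real.exp_le_one_iff.2 (mul_nonpos_of_nonneg_of_nonpos hγ.le hu)) hs.1 ((hten z hz).1 0)
      (by linarith [hz.one_sub_zero_eq])

lemma admissibleSet_subset_interior_integrableExpSet (t : ℝ≥0) :
    admissibleSet γ t ⊆ interior (integrableExpSet (fun ω => X t ω 0) P) :=
  interior_maximal (fun _ hu => hX.integrable_exp_mul_fst hten hγ hu) (isOpen_admissibleSet γ t)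

theorem mgf_fst (hx : x₀ 0 ≤ x₀ 1) {u : ℝ} (hu : u ∈ admissibleSet γ t) :
    mgf (fun ω => X t ω 0) P u = genFun γ (Real.exp (γ * u)) t x₀ := by
  have hmgf : AnalyticOnNhd ℝ (mgf (fun ω => X t ω 0) P) (admissibleSet γ t) :=
    analyticOnNhd_mgf.mono (hX.admissibleSet_subset_interior_integrableExpSet hten hγ t)
  have hgen : AnalyticOnNhd ℝ (fun u => genFun γ (Real.exp (γ * u)) t x₀) (admissibleSet γ t) :=
    fun u (hu : _ < _) => analyticAt_genFun_exp (sub_pos.2 hu)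
      (sub_mul_pos hγ t.coe_nonneg (Real.exp_pos _) (sub_pos.2 hu)) x₀
  refine hmgf.eqOn_of_preconnected_of_eventuallyEq hgen
    (isPreconnected_admissibleSet hγ.le t.coe_nonneg)
    (mem_admissibleSet_of_nonpos hγ.le t.coe_nonneg (neg_one_lt_zero.le)) ?_ hu
  filter_upwards [Iio_mem_nhds neg_one_lt_zero] with u (hu : u < 0)
  exact hX.mgf_fst_of_nonpos hten hγ hx hu.le

end IsContinuumPolyaWalk

end PolyaWalk

section Cumulants

variable {Ω : Type*} [MeasurableSpace Ω] {P : Measure Ω} [IsProbabilityMeasure P] {Y : Ω → ℝ}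

lemma variance_eq_iteratedDeriv_two_cgf_zero (h : 0 ∈ interior (integrableExpSet Y P)) :
    Var[Y; P] = iteratedDeriv 2 (cgf Y P) 0 := by
  simpa using variance_tilted_mul h

lemma integral_eq_of_hasDerivAt_cgf (h : 0 ∈ interior (integrableExpSet Y P)) {m : ℝ}
    (hm : HasDerivAt (cgf Y P) m 0) : ∫ ω, Y ω ∂P = m := by
  simpa [hm.deriv] using (deriv_cgf_zero h).symm

lemma variance_eq_of_hasDerivAt_cgf (h : 0 ∈ interior (integrableExpSet Y P)) {g : ℝ → ℝ} {v : ℝ}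
    (hg : ∀ᶠ u in 𝓝 0, HasDerivAt (cgf Y P) (g u) u) (hv : HasDerivAt g v 0) :
    Var[Y; P] = v := by
  have hderiv : deriv (cgf Y P) =ᶠ[𝓝 0] g := hg.mono fun u hu => hu.deriv
  rw [variance_eq_iteratedDeriv_two_cgf_zero h, iteratedDeriv_succ, iteratedDeriv_one,
    hderiv.deriv_eq, hv.deriv]

end Cumulants

namespace PolyaWalk

section LogAffineExp

variable {γ b u : ℝ}

lemma hasDerivAt_one_add_mul_exp_sub_one (γ b u : ℝ) :
    HasDerivAt (fun u => 1 + b * (Real.exp (γ * u) - 1)) (γ * (b * Real.exp (γ * u))) u := by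
  refine (((((hasDerivAt_id u).const_mul γ).exp.sub_const 1).const_mul b).const_add
    1).congr_deriv ?_
  simp only [id_eq]
  ring

lemma hasDerivAt_log_one_add_mul_exp_sub_one (h : 0 < 1 + b * (Real.exp (γ * u) - 1)) :
    HasDerivAt (fun u => Real.log (1 + b * (Real.exp (γ * u) - 1)))
      (γ * (b * Real.exp (γ * u)) / (1 + b * (Real.exp (γ * u) - 1))) u :=
  (hasDerivAt_one_add_mul_exp_sub_one γ b u).log h.ne'

lemma hasDerivAt_logDeriv_one_add_mul_exp_sub_one (γ b : ℝ) :
    HasDerivAt (fun u => γ * (b * Real.exp (γ * u)) / (1 + b * (Real.exp (γ * u) - 1)))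
      (γ ^ 2 * (b * (1 - b))) 0 := by
  have hexp : HasDerivAt (fun u => γ * (b * Real.exp (γ * u))) (γ * (b * γ)) 0 := by
    simpa using (((hasDerivAt_id (0 : ℝ)).const_mul γ).exp.const_mul b).const_mul γ
  refine (hexp.div (hasDerivAt_one_add_mul_exp_sub_one γ b 0) (by simp)).congr_deriv ?_
  simp only [mul_zero, Real.exp_zero, sub_self, add_zero]
  ring

end LogAffineExp

lemma log_genFun {γ w t : ℝ} (hD : 0 < 1 - γ * t * (w - 1)) (hN : 0 < w - γ * t * (w - 1))
    (z : Fin 2 → ℝ) : Real.log (genFun γ w t z) =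
      z 0 / γ * Real.log (1 + (1 - γ * t) * (w - 1)) -
        z 1 / γ * Real.log (1 + -(γ * t) * (w - 1)) := by
  rw [genFun, Real.log_div (Real.rpow_pos_of_pos hN _).ne' (Real.rpow_pos_of_pos hD _).ne',
    Real.log_rpow hN, Real.log_rpow hD]
  congr 4 <;> ring

lemma tendsto_mul_exp_div_sub_one (γ s : ℝ) :
    Tendsto (fun t : ℝ≥0 => γ * t * (Real.exp (γ * (s / t)) - 1)) atTop (𝓝 (γ ^ 2 * s)) := by
  have hderiv : HasDerivAt (fun h => Real.exp (γ * (s * h))) (γ * s) 0 := by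
    simpa using (((hasDerivAt_id (0 : ℝ)).const_mul s).const_mul γ).exp
  have hinv : Tendsto (fun t : ℝ≥0 => (t : ℝ)⁻¹) atTop (𝓝[>] 0) :=
    tendsto_inv_atTop_nhdsGT_zero.comp (NNReal.tendsto_coe_atTop.2 tendsto_id)
  have hlim := (hderiv.tendsto_slope_zero_right.comp hinv).const_mul γ
  refine (hlim.congr fun t => ?_).trans_eq (by ring_nf)
  simp [div_eq_mul_inv, mul_assoc]

lemma tendsto_genFun_exp_div {γ s : ℝ} (hs : γ ^ 2 * s < 1) (z : Fin 2 → ℝ) :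
    Tendsto (fun t : ℝ≥0 => genFun γ (Real.exp (γ * (s / t))) t z) atTop
      (𝓝 (1 / (1 - γ ^ 2 * s) ^ ((z 1 - z 0) / γ))) := by
  have hmul := tendsto_mul_exp_div_sub_one γ s
  have hexp : Tendsto (fun t : ℝ≥0 => Real.exp (γ * (s / t))) atTop (𝓝 1) := by
    have hdiv : Tendsto (fun t : ℝ≥0 => s / (t : ℝ)) atTop (𝓝 0) :=
      (NNReal.tendsto_coe_atTop.2 tendsto_id).const_div_atTop s
    simpa using (hdiv.const_mul γ).rexp
  have hpos : 0 < 1 - γ ^ 2 * s := sub_pos.2 hs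
  have hlim := ((hexp.sub hmul).rpow_const (p := z 0 / γ) (.inl hpos.ne')).div
    ((hmul.const_sub 1).rpow_const (p := z 1 / γ) (.inl hpos.ne'))
    (Real.rpow_pos_of_pos hpos _).ne'
  rwa [← Real.rpow_sub hpos, ← sub_div, ← neg_sub (z 1), neg_div, Real.rpow_neg hpos.le,
    ← one_div] at hlim

lemma eventually_div_mem_admissibleSet {γ s : ℝ} (hs : γ ^ 2 * s < 1) :
    ∀ᶠ t : ℝ≥0 in atTop, s / t ∈ admissibleSet γ t :=
  (tendsto_mul_exp_div_sub_one γ s).eventually_lt_const hs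

namespace IsContinuumPolyaWalk

variable {γ : ℝ} {x₀ : Fin 2 → ℝ} {Ω : Type*} {X : ℝ≥0 → Ω → Fin 2 → ℝ}
  [MeasurableSpace Ω] {P : Measure Ω} [IsProbabilityMeasure P]
  (hX : IsContinuumPolyaWalk P (navigation γ) x₀ X) (hten : Tenable (navigation γ) x₀)
  (hγ : 0 < γ)
include hX hten hγ

lemma zero_mem_interior_integrableExpSet (t : ℝ≥0) :
    0 ∈ interior (integrableExpSet (fun ω => X t ω 0) P) :=
  hX.admissibleSet_subset_interior_integrableExpSet hten hγ t
    (mem_admissibleSet_of_nonpos hγ.le t.coe_nonneg le_rfl)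

lemma memLp_fst (t p : ℝ≥0) : MemLp (fun ω => X t ω 0) p P :=
  memLp_of_mem_interior_integrableExpSet (hX.zero_mem_interior_integrableExpSet hten hγ t) p

lemma memLp_snd (t p : ℝ≥0) : MemLp (fun ω => X t ω 1) p P :=
  ((hX.memLp_fst hten hγ t p).add (memLp_const (x₀ 1 - x₀ 0))).ae_eq
    ((hX.ae_snd_eq_fst_add hten t).mono fun _ hω => hω.symm)

variable (hx : x₀ 0 ≤ x₀ 1)
include hx

lemma hasDerivAt_cgf_fst {t : ℝ≥0} {u : ℝ} (hu : u ∈ admissibleSet γ t) :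
    HasDerivAt (cgf (fun ω => X t ω 0) P)
      (x₀ 0 / γ * (γ * ((1 - γ * t) * Real.exp (γ * u)) /
          (1 + (1 - γ * t) * (Real.exp (γ * u) - 1))) -
        x₀ 1 / γ * (γ * (-(γ * t) * Real.exp (γ * u)) /
          (1 + -(γ * t) * (Real.exp (γ * u) - 1)))) u := by
  have hD {v : ℝ} (hv : v ∈ admissibleSet γ t) : 0 < 1 - γ * t * (Real.exp (γ * v) - 1) :=
    sub_pos.2 hv
  have hN {v : ℝ} (hv : v ∈ admissibleSet γ t) :
      0 < Real.exp (γ * v) - γ * t * (Real.exp (γ * v) - 1) :=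
    sub_mul_pos hγ t.coe_nonneg (Real.exp_pos _) (hD hv)
  refine HasDerivAt.congr_of_eventuallyEq (.sub
    ((hasDerivAt_log_one_add_mul_exp_sub_one (by linarith [hN hu])).const_mul _)
    ((hasDerivAt_log_one_add_mul_exp_sub_one (by linarith [hD hu])).const_mul _)) ?_
  filter_upwards [(isOpen_admissibleSet γ t).mem_nhds hu] with v hv
  rw [cgf, hX.mgf_fst hten hγ hx hv, log_genFun (hD hv) (hN hv)]
  rfl

theorem integral_fst (t : ℝ≥0) : ∫ ω, X t ω 0 ∂P = (x₀ 1 - x₀ 0) * γ * t + x₀ 0 := by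
  rw [integral_eq_of_hasDerivAt_cgf (hX.zero_mem_interior_integrableExpSet hten hγ t)
    (hX.hasDerivAt_cgf_fst hten hγ hx
      (mem_admissibleSet_of_nonpos hγ.le t.coe_nonneg le_rfl))]
  simp only [mul_zero, Real.exp_zero, sub_self, add_zero, mul_one, div_one]
  field_simp
  ring

theorem integral_snd (t : ℝ≥0) : ∫ ω, X t ω 1 ∂P = (x₀ 1 - x₀ 0) * γ * t + x₀ 1 := by
  rw [integral_congr_ae (hX.ae_snd_eq_fst_add hten t), integral_add
    ((hX.memLp_fst hten hγ t 1).integrable le_rfl) (integrable_const _),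
    hX.integral_fst hten hγ hx, integral_const]
  simp only [probReal_univ, one_smul]
  ring

theorem variance_fst (t : ℝ≥0) : Var[fun ω => X t ω 0; P] =
    (x₀ 1 - x₀ 0) * γ ^ 3 * (t : ℝ) ^ 2 + (2 * x₀ 0 + (x₀ 1 - x₀ 0)) * γ ^ 2 * t := by
  have hnhds : admissibleSet γ t ∈ 𝓝 0 := (isOpen_admissibleSet γ t).mem_nhds
    (mem_admissibleSet_of_nonpos hγ.le t.coe_nonneg le_rfl)
  rw [variance_eq_of_hasDerivAt_cgf (hX.zero_mem_interior_integrableExpSet hten hγ t)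
    (mem_of_superset hnhds fun u hu => hX.hasDerivAt_cgf_fst hten hγ hx hu)
    (((hasDerivAt_logDeriv_one_add_mul_exp_sub_one γ _).const_mul _).sub
      ((hasDerivAt_logDeriv_one_add_mul_exp_sub_one γ _).const_mul _))]
  field_simp
  ring

theorem variance_snd (t : ℝ≥0) : Var[fun ω => X t ω 1; P] =
    (x₀ 1 - x₀ 0) * γ ^ 3 * (t : ℝ) ^ 2 + (2 * x₀ 0 + (x₀ 1 - x₀ 0)) * γ ^ 2 * t := by
  rw [variance_congr (hX.ae_snd_eq_fst_add hten t),
    variance_add_const (hX.memLp_fst hten hγ t 1).aestronglyMeasurable,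
    hX.variance_fst hten hγ hx]

omit hx in
lemma eventually_integrable_exp_mul_fst_div {s : ℝ} (hs : γ ^ 2 * s < 1) :
    ∀ᶠ t : ℝ≥0 in atTop, Integrable (fun ω => Real.exp (s * (X t ω 0 / t))) P := by
  filter_upwards [eventually_div_mem_admissibleSet hs] with t ht
  simpa only [mul_comm_div] using hX.integrable_exp_mul_fst hten hγ ht

theorem tendsto_mgf_fst_div {s : ℝ} (hs : γ ^ 2 * s < 1) :
    Tendsto (fun t : ℝ≥0 => mgf (fun ω => X t ω 0 / t) P s) atTop
      (𝓝 (1 / (1 - γ ^ 2 * s) ^ ((x₀ 1 - x₀ 0) / γ))) := by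
  refine (tendsto_genFun_exp_div hs x₀).congr' ?_
  filter_upwards [eventually_div_mem_admissibleSet hs] with t ht
  rw [← hX.mgf_fst hten hγ hx ht]
  simp only [mgf, mul_comm_div]

omit hx

theorem tendstoInDistribution_fst_div (hx : x₀ 0 < x₀ 1)
    [IsProbabilityMeasure (gammaMeasure ((x₀ 1 - x₀ 0) / γ) (1 / γ ^ 2))] :
    TendstoInDistribution (fun (t : ℝ≥0) ω => X t ω 0 / t) atTop (id : ℝ → ℝ) (fun _ => P)
      (gammaMeasure ((x₀ 1 - x₀ 0) / γ) (1 / γ ^ 2)) := by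
  refine tendstoInDistribution_of_tendsto_mgf_of_nonneg
    (fun t => ((measurable_pi_apply 0).comp_aemeasurable (hX.aemeasurable hten t)).div_const _)
    aemeasurable_id
    (fun t => (hX.ae_fst_nonneg hten t).mono fun _ hω => div_nonneg hω t.coe_nonneg)
    ae_nonneg_gammaMeasure fun s hs => ?_
  have hs' : γ ^ 2 * s < 1 := (mul_nonpos_of_nonneg_of_nonpos (sq_nonneg γ) hs).trans_lt one_pos
  rw [mgf_id_gammaMeasure_one_div (div_pos (sub_pos.2 hx) hγ) (pow_pos hγ 2) hs']
  exact hX.tendsto_mgf_fst_div hten hγ hx.le hs'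

theorem tendstoInDistribution_snd_div (hx : x₀ 0 < x₀ 1)
    [IsProbabilityMeasure (gammaMeasure ((x₀ 1 - x₀ 0) / γ) (1 / γ ^ 2))] :
    TendstoInDistribution (fun (t : ℝ≥0) ω => X t ω 1 / t) atTop (id : ℝ → ℝ) (fun _ => P)
      (gammaMeasure ((x₀ 1 - x₀ 0) / γ) (1 / γ ^ 2)) := by
  have hshift : Tendsto (fun t : ℝ≥0 => (x₀ 1 - x₀ 0) / (t : ℝ)) atTop (𝓝 0) :=
    (NNReal.tendsto_coe_atTop.2 tendsto_id).const_div_atTop _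
  refine ((hX.tendstoInDistribution_fst_div hten hγ hx).add_of_tendstoInMeasure_const
    (tendstoInMeasure_const_of_tendsto hshift) fun _ => aemeasurable_const).congr
    (fun t => ?_) (ae_of_all _ fun x => add_zero x)
  filter_upwards [hX.ae_snd_eq_fst_add hten t] with ω hω
  simp only [hω, add_div, Pi.add_apply]

end IsContinuumPolyaWalk

end PolyaWalk

theorem mainTheorem4 {Ω : Type*} [MeasurableSpace Ω] (P : Measure Ω) [IsProbabilityMeasure P]
    (γ x₀ y₀ lam : ℝ) (hγ : 0 < γ) (hlam : lam = y₀ - x₀) (hpos : 0 < lam)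
    (hten : PolyaWalk.Tenable !![-γ, -γ; γ, γ] ![x₀, y₀])
    (X : ℝ≥0 → Ω → Fin 2 → ℝ)
    (hX : PolyaWalk.IsContinuumPolyaWalk P !![-γ, -γ; γ, γ] ![x₀, y₀] X) :
    -- the moment generating function of the first coordinate, in both closed forms
    (∀ (t : ℝ≥0) (u : ℝ), γ * t * (Real.exp (γ * u) - 1) < 1 →
      Integrable (fun ω => Real.exp (u * X t ω 0)) P ∧
      mgf (fun ω => X t ω 0) P u =
        1 / (1 - γ * t * (Real.exp (γ * u) - 1)) ^ (lam / γ) *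
          ((Real.exp (γ * u) - γ * t * (Real.exp (γ * u) - 1)) /
            (1 - γ * t * (Real.exp (γ * u) - 1))) ^ (x₀ / γ) ∧
      mgf (fun ω => X t ω 0) P u =
        (Real.exp (γ * u) - γ * t * (Real.exp (γ * u) - 1)) ^ (x₀ / γ) /
          (1 - γ * t * (Real.exp (γ * u) - 1)) ^ (y₀ / γ)) ∧
    -- means and variances of both coordinates
    (∀ t : ℝ≥0,
      MemLp (fun ω => X t ω 0) 2 P ∧ MemLp (fun ω => X t ω 1) 2 P ∧
      ∫ ω, X t ω 0 ∂P = lam * γ * t + x₀ ∧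
      ∫ ω, X t ω 1 ∂P = lam * γ * t + y₀ ∧
      Var[fun ω => X t ω 0; P] = lam * γ ^ 3 * (t : ℝ) ^ 2 + (2 * x₀ + lam) * γ ^ 2 * t ∧
      Var[fun ω => X t ω 1; P] = lam * γ ^ 3 * (t : ℝ) ^ 2 + (2 * x₀ + lam) * γ ^ 2 * t) ∧
    -- the limit of the moment generating function of `X(t) / t`
    (∀ s : ℝ, γ ^ 2 * s < 1 →
      (∀ᶠ t : ℝ≥0 in atTop, Integrable (fun ω => Real.exp (s * (X t ω 0 / t))) P) ∧
      Tendsto (fun t : ℝ≥0 => mgf (fun ω => X t ω 0 / t) P s) atTop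
        (𝓝 (1 / (1 - γ ^ 2 * s) ^ (lam / γ)))) ∧
    -- convergence in distribution to the gamma law of shape `lam / γ` and scale `γ ^ 2`
    -- (Mathlib's second parameter is the rate, the inverse of the scale)
    (∃ _ : IsProbabilityMeasure (gammaMeasure (lam / γ) (1 / γ ^ 2)),
      TendstoInDistribution (fun (t : ℝ≥0) ω => X t ω 0 / t) atTop
        (id : ℝ → ℝ) (fun _ => P) (gammaMeasure (lam / γ) (1 / γ ^ 2)) ∧
      TendstoInDistribution (fun (t : ℝ≥0) ω => X t ω 1 / t) atTop
        (id : ℝ → ℝ) (fun _ => P) (gammaMeasure (lam / γ) (1 / γ ^ 2))) := by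
  subst hlam
  have hx : (![x₀, y₀] : Fin 2 → ℝ) 0 < (![x₀, y₀] : Fin 2 → ℝ) 1 := sub_pos.1 hpos
  have hgamma := isProbabilityMeasure_gammaMeasure (div_pos (sub_pos.2 hx) hγ)
    (one_div_pos.2 (pow_pos hγ 2))
  refine ⟨fun t u hu => ?_, fun t => ?_, fun s hs => ?_, ?_⟩
  · have hD := sub_pos.2 hu
    have hmgf := hX.mgf_fst hten hγ hx.le hu
    have hN := PolyaWalk.sub_mul_pos hγ t.coe_nonneg (Real.exp_pos _) hD
    exact ⟨hX.integrable_exp_mul_fst hten hγ hu,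
      hmgf.trans (PolyaWalk.genFun_eq_mul_div_rpow hD hN.le x₀ y₀), hmgf⟩
  · exact ⟨hX.memLp_fst hten hγ t 2, hX.memLp_snd hten hγ t 2, hX.integral_fst hten hγ hx.le t,
      hX.integral_snd hten hγ hx.le t, hX.variance_fst hten hγ hx.le t,
      hX.variance_snd hten hγ hx.le t⟩
  · exact ⟨hX.eventually_integrable_exp_mul_fst_div hten hγ hs,
      hX.tendsto_mgf_fst_div hten hγ hx.le hs⟩
  · exact ⟨hgamma, hX.tendstoInDistribution_fst_div hten hγ hx,
      hX.tendstoInDistribution_snd_div hten hγ hx⟩
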